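/- **Theorem 6.1 (conjugacy).** Let $X$ and $Y$ be locally compact Hausdorff spaces, and let $\alpha$ and $\beta$ be free partial actions of $\mathbb{Z}^+=\{0,1,2,\dots\}$ on $X$ and $Y$, respectively, both having the domain ordering property. Then there is a continuous (complex) algebra isomorphism of $C_0(X)\times_\alpha\mathbb{Z}^+$ onto $C_0(Y)\times_\beta\mathbb{Z}^+$ if and only if $\alpha$ and $\beta$ are conjugate. Here the terms mean the following. For $\Sigma=\mathbb{Z}^+$ or $\Sigma=\mathbb{Z}$, a *partial action* of $\Sigma$ on $X$ is a family of homeomorphisms $\alpha_t\colon X_{-t}\to X_t$ $(t\in\Sigma)$ between open subsets of $X$ such that for all $s,t\in\Sigma$: $\alpha_s(X_{-s}\cap X_t)=X_s\cap X_{s+t}$; $\alpha_t(X_{-t}\cap X_{-s-t})=X_t\cap X_{-s}$; $\alpha_{s+t}(x)=\alpha_s(\alpha_t(x))$ for $x\in X_{-t}\cap X_{-s-t}$; and $X_0=X$, $\alpha_0=\mathrm{id}_X$. It is *free* if $\alpha_t(x)=x$ for some $x\in X_{-t}$ only when $t=0$, and has the *domain ordering property* if $X_{-s-t}\subseteq X_{-t}$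 for all $s,t\in\Sigma$. Two partial actions $\alpha$ of $\mathbb{Z}^+$ on $X$ and $\beta$ of $\mathbb{Z}^+$ on $Y$ are *conjugate* if there is a homeomorphism $\tau\colon X\to Y$ such that for every $s\in\mathbb{Z}^+$: $\tau(X_{-s})=Y_{-s}$, $\tau(X_s)=Y_s$, and $\beta_s(\tau(x))=\tau(\alpha_s(x))$ for all $x\in X_{-s}$. A partial action $\alpha$ of $\mathbb{Z}^+$ extends uniquely to a partial action of $\mathbb{Z}$, by $\alpha_{-t}=\alpha_t^{-1}$. Put $D_n=\{f\in C_0(X): f=0 \text{ off } X_n\}$ for $n\in\mathbb{Z}$, and let $\mathcal{P}$ be the $*$-algebra of finite formal sums $\sum_{n\in\mathbb{Z}} f_nU^n$ with $f_n\in D_n$, whose product and involution are determined by $fU^n\,gU^m=hU^{n+m}$ with $h(x)=f(x)\,g(\alpha_n^{-1}(x))$ for $x\in X_n$ and $h(x)=0$ otherwise, and $(fU^n)^*=kU^{-n}$ with $k(x)=\overline{f(\alpha_n(x))}$ for $x\in X_{-n}$ and $k(x)=0$ otherwise. The partial crossed product $C_0(X)\times_\alpha\mathbb{Z}$ is the completion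 of $\mathcal{P}$ in the norm $\|p\|=\sup_\pi\|\pi(p)\|$, where $\pi$ runs over the $*$-representations of $\mathcal{P}$ on Hilbert spaces that are continuous for the norm $\|\sum f_nU^n\|_L=\sum\|f_n\|_\infty$. The Banach algebra $C_0(X)\times_\alpha\mathbb{Z}^+$ is the closure in $C_0(X)\times_\alpha\mathbb{Z}$ of the polynomials $\sum f_nU^n$ with $f_n=0$ for all $n<0$. -/

import Mathlib

open scoped ZeroAtInfty ENNReal DirectSum

noncomputable section

universe u v w

/-- A partial action of an additive monoid `M` on a topological space `X`: a family of homeomorphisms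
`α_t : X_{-t} → X_t` between open subsets of `X`, where `X_{-t}` is `(map t).source` and `X_t` is
`(map t).target`.  The values of `map t` outside its source carry no information.
The monoid `M` is either a positive cone (here `ℕ`, standing for `ℤ⁺`) or an abelian group.  In the
group case `X_{-t} = (map t).source = (map (-t)).target` follows from the axioms, see
`PartialAction.source_neg` below. -/
structure PartialAction (M : Type w) [AddMonoid M] (X : Type u) [TopologicalSpace X] where
  /-- The partial homeomorphism `α_t`. -/
  map : M → OpenPartialHomeomorph X X
  /-- `α_s(X_{-s} ∩ X_t) = X_s ∩ X_{s+t}` -/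
  image_inter_target : ∀ s t, map s '' ((map s).source ∩ (map t).target) =
    (map s).target ∩ (map (s + t)).target
  /-- `α_t(X_{-t} ∩ X_{-s-t}) = X_t ∩ X_{-s}` -/
  image_inter_source : ∀ s t, map t '' ((map t).source ∩ (map (s + t)).source) =
    (map t).target ∩ (map s).source
  /-- `α_{s+t} = α_s ∘ α_t` on `X_{-t} ∩ X_{-s-t}` -/
  comp_apply : ∀ s t, ∀ x ∈ (map t).source ∩ (map (s + t)).source,
    map (s + t) x = map s (map t x)
  /-- `X_0 = X` -/
  source_zero : (map 0).source = Set.univ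
  /-- `α_0 = id` -/
  zero_apply : ∀ x, map 0 x = x

namespace PartialAction

section Basic

variable {M : Type w} [AddMonoid M] {X : Type u} [TopologicalSpace X]

/-- Free partial actions: `α_t(x) = x` only for `t = 0`. -/
def IsFree (α : PartialAction M X) : Prop :=
  ∀ t, ∀ x ∈ (α.map t).source, α.map t x = x → t = 0

/-- The domain ordering property: `X_{-s-t} ⊆ X_{-t}`. -/
def DomainOrdering (α : PartialAction M X) : Prop :=
  ∀ s t, (α.map (s + t)).source ⊆ (α.map t).source

/-- Two partial actions are conjugate if one homeomorphism `τ : X → Y` carries, for every `s`, the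
domain of `α_s` onto that of `β_s`, the range of `α_s` onto that of `β_s`, and satisfies
`β_s ∘ τ = τ ∘ α_s` as partial homeomorphisms. -/
def Conjugate {Y : Type v} [TopologicalSpace Y] (α : PartialAction M X) (β : PartialAction M Y) :
    Prop :=
  ∃ τ : X ≃ₜ Y, ∀ s, τ '' (α.map s).source = (β.map s).source ∧
    τ '' (α.map s).target = (β.map s).target ∧
    ∀ x ∈ (α.map s).source, β.map s (τ x) = τ (α.map s x)

/-- The graph of the partial map `α_t`. -/
def Arrow (α : PartialAction M X) (t : M) (x y : X) : Prop :=
  x ∈ (α.map t).source ∧ α.map t x = y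

/-- Third arrow property: I and III imply II. -/
theorem arrow_two (α : PartialAction M X) {s t : M} {x y z : X}
    (h1 : α.Arrow t x y) (h3 : α.Arrow (s + t) x z) : α.Arrow s y z := by
  obtain ⟨h1, rfl⟩ := h1
  obtain ⟨h3, rfl⟩ := h3
  have h : α.map t x ∈ (α.map t).target ∩ (α.map s).source := by
    rw [← α.image_inter_source s t]
    exact ⟨x, ⟨h1, h3⟩, rfl⟩
  exact ⟨h.2, (α.comp_apply s t x ⟨h1, h3⟩).symm⟩

/-- Third arrow property: I and II imply III. -/
theorem arrow_three (α : PartialAction M X) {s t : M} {x y z : X}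
    (h1 : α.Arrow t x y) (h2 : α.Arrow s y z) : α.Arrow (s + t) x z := by
  obtain ⟨h1, rfl⟩ := h1
  obtain ⟨h2, rfl⟩ := h2
  have h : α.map t x ∈ (α.map t).target ∩ (α.map s).source := ⟨(α.map t).map_source h1, h2⟩
  rw [← α.image_inter_source s t] at h
  obtain ⟨x', ⟨h1', h3'⟩, he⟩ := h
  obtain rfl := (α.map t).injOn h1' h1 he
  exact ⟨h3', α.comp_apply s t x' ⟨h1, h3'⟩⟩

/-- Third arrow property: II and III imply I. -/
theorem arrow_one (α : PartialAction M X) {s t : M} {x y z : X}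
    (h2 : α.Arrow s y z) (h3 : α.Arrow (s + t) x z) : α.Arrow t x y := by
  obtain ⟨h2, rfl⟩ := h2
  obtain ⟨h3, h3e⟩ := h3
  have h : α.map s y ∈ (α.map s).target ∩ (α.map (s + t)).target :=
    ⟨(α.map s).map_source h2, h3e ▸ (α.map (s + t)).map_source h3⟩
  rw [← α.image_inter_target s t] at h
  obtain ⟨y', ⟨h2', hy'⟩, he⟩ := h
  obtain rfl := (α.map s).injOn h2' h2 he
  have hx' : α.Arrow t ((α.map t).symm y') y' :=
    ⟨(α.map t).map_target hy', (α.map t).right_inv hy'⟩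
  have h3' := α.arrow_three hx' ⟨h2, rfl⟩
  have : (α.map t).symm y' = x := (α.map (s + t)).injOn h3'.1 h3 (h3'.2.trans h3e.symm)
  exact this ▸ hx'

/-- A family satisfying the third arrow property is a partial action. -/
def ofArrow (m : M → OpenPartialHomeomorph X X)
    (h0 : (m 0).source = Set.univ) (h0' : ∀ x, m 0 x = x)
    (h1 : ∀ s t y x, y ∈ (m s).source → x ∈ (m (s + t)).source → m (s + t) x = m s y →
      x ∈ (m t).source ∧ m t x = y)
    (h2 : ∀ s t x, x ∈ (m t).source → x ∈ (m (s + t)).source →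
      m t x ∈ (m s).source ∧ m s (m t x) = m (s + t) x)
    (h3 : ∀ s t x, x ∈ (m t).source → m t x ∈ (m s).source →
      x ∈ (m (s + t)).source ∧ m (s + t) x = m s (m t x)) : PartialAction M X where
  map := m
  image_inter_target s t := by
    ext z
    constructor
    · rintro ⟨y, ⟨hy, hyt⟩, rfl⟩
      refine ⟨(m s).map_source hy, ?_⟩
      have h := h3 s t ((m t).symm y) ((m t).map_target hyt) (by rwa [(m t).right_inv hyt])
      rw [(m t).right_inv hyt] at h
      exact h.2 ▸ (m (s + t)).map_source h.1
    · rintro ⟨hz, hz'⟩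
      have h := h1 s t ((m s).symm z) ((m (s + t)).symm z) ((m s).map_target hz)
        ((m (s + t)).map_target hz') (by rw [(m s).right_inv hz, (m (s + t)).right_inv hz'])
      exact ⟨(m s).symm z, ⟨(m s).map_target hz, h.2 ▸ (m t).map_source h.1⟩, (m s).right_inv hz⟩
  image_inter_source s t := by
    ext y
    constructor
    · rintro ⟨x, ⟨hx, hx'⟩, rfl⟩
      exact ⟨(m t).map_source hx, (h2 s t x hx hx').1⟩
    · rintro ⟨hy, hy'⟩
      exact ⟨(m t).symm y, ⟨(m t).map_target hy, (h3 s t ((m t).symm y) ((m t).map_target hy)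
        (by rwa [(m t).right_inv hy])).1⟩, (m t).right_inv hy⟩
  comp_apply s t x hx := (h2 s t x hx.1 hx.2).2.symm
  source_zero := h0
  zero_apply := h0'

end Basic

section Extension

variable {X : Type u} [TopologicalSpace X]

/-- The partial homeomorphisms `α_n`, `n ∈ ℤ`: `α_{-n} = α_n⁻¹` for `n > 0`. -/
def extMap (α : PartialAction ℕ X) : ℤ → OpenPartialHomeomorph X X
  | Int.ofNat n => α.map n
  | Int.negSucc n => (α.map (n + 1)).symm

theorem extMap_arrow (α : PartialAction ℕ X) (n : ℕ) (k : ℤ) (hk : k = n) (x y : X) :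
    x ∈ (α.extMap k).source ∧ α.extMap k x = y ↔ α.Arrow n x y := by
  subst hk
  rfl

theorem extMap_arrow_neg (α : PartialAction ℕ X) (n : ℕ) (k : ℤ) (hk : k = -n) (x y : X) :
    x ∈ (α.extMap k).source ∧ α.extMap k x = y ↔ α.Arrow n y x := by
  subst hk
  rcases n with _ | n
  · have h0 : α.extMap (-((0 : ℕ) : ℤ)) = α.map 0 := rfl
    rw [h0]
    simp only [Arrow, α.source_zero, α.zero_apply, Set.mem_univ, true_and]
    exact eq_comm
  · have h0 : α.extMap (-((n + 1 : ℕ) : ℤ)) = (α.map (n + 1)).symm := rfl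
    rw [h0]
    constructor
    · rintro ⟨h, rfl⟩
      exact ⟨(α.map (n + 1)).map_target h, (α.map (n + 1)).right_inv h⟩
    · rintro ⟨h, rfl⟩
      exact ⟨(α.map (n + 1)).map_source h, (α.map (n + 1)).left_inv h⟩

theorem extMap_symm (α : PartialAction ℕ X) (k : ℤ) (x y : X) :
    (x ∈ (α.extMap (-k)).source ∧ α.extMap (-k) x = y) ↔
      (y ∈ (α.extMap k).source ∧ α.extMap k y = x) := by
  obtain ⟨n, rfl | rfl⟩ := k.eq_nat_or_neg
  · rw [α.extMap_arrow_neg n _ rfl, α.extMap_arrow n _ rfl]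
  · rw [α.extMap_arrow_neg n _ rfl, α.extMap_arrow n _ (neg_neg _)]

theorem extMap_trans (α : PartialAction ℕ X) (s t : ℤ) (x y z : X)
    (h1 : x ∈ (α.extMap t).source ∧ α.extMap t x = y)
    (h2 : y ∈ (α.extMap s).source ∧ α.extMap s y = z) :
    x ∈ (α.extMap (s + t)).source ∧ α.extMap (s + t) x = z := by
  obtain ⟨m, rfl | rfl⟩ := s.eq_nat_or_neg <;> obtain ⟨n, rfl | rfl⟩ := t.eq_nat_or_neg
  · rw [α.extMap_arrow _ _ rfl] at h1 h2
    rw [α.extMap_arrow (m + n) _ (by push_cast; ring)]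
    exact α.arrow_three h1 h2
  · rw [α.extMap_arrow_neg _ _ rfl] at h1
    rw [α.extMap_arrow _ _ rfl] at h2
    rcases le_total n m with h | h
    · obtain ⟨d, rfl⟩ := Nat.exists_eq_add_of_le' h
      rw [α.extMap_arrow d _ (by push_cast; ring)]
      exact α.arrow_two h1 h2
    · obtain ⟨d, rfl⟩ := Nat.exists_eq_add_of_le' h
      rw [α.extMap_arrow_neg d _ (by push_cast; ring)]
      exact α.arrow_two h2 h1
  · rw [α.extMap_arrow _ _ rfl] at h1
    rw [α.extMap_arrow_neg _ _ rfl] at h2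
    rcases le_total m n with h | h
    · obtain ⟨d, rfl⟩ := Nat.exists_eq_add_of_le h
      rw [α.extMap_arrow d _ (by push_cast; ring)]
      exact α.arrow_one h2 h1
    · obtain ⟨d, rfl⟩ := Nat.exists_eq_add_of_le h
      rw [α.extMap_arrow_neg d _ (by push_cast; ring)]
      exact α.arrow_one h1 h2
  · rw [α.extMap_arrow_neg _ _ rfl] at h1 h2
    rw [α.extMap_arrow_neg (n + m) _ (by push_cast; ring)]
    exact α.arrow_three h2 h1

/-- The (unique) extension of a partial action of `ℤ⁺` to a partial action of `ℤ`. -/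
def extend (α : PartialAction ℕ X) : PartialAction ℤ X :=
  ofArrow α.extMap α.source_zero α.zero_apply
    (fun s t y x hy hx h => by
      have h' := α.extMap_trans (-s) (s + t) x (α.extMap s y) y ⟨hx, h⟩
        ((α.extMap_symm s _ _).2 ⟨hy, rfl⟩)
      rwa [neg_add_cancel_left] at h')
    (fun s t x hx hx' => by
      have h' := α.extMap_trans (s + t) (-t) (α.extMap t x) x (α.extMap (s + t) x)
        ((α.extMap_symm t _ _).2 ⟨hx, rfl⟩) ⟨hx', rfl⟩
      rwa [add_neg_cancel_right] at h')
    (fun s t x hx hx' => α.extMap_trans s t x _ _ ⟨hx, rfl⟩ ⟨hx', rfl⟩)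

end Extension

section Group

variable {G : Type w} [AddCommGroup G] {X : Type u} [TopologicalSpace X] (α : PartialAction G X)

theorem arrow_neg {t : G} {x y : X} (h : α.Arrow t x y) : α.Arrow (-t) y x := by
  refine α.arrow_two h ?_
  rw [neg_add_cancel]
  exact ⟨α.source_zero ▸ Set.mem_univ x, α.zero_apply x⟩

/-- `X_{-t}`, the domain of `α_t`, is the range of `α_{-t}`. -/
theorem source_neg (t : G) : (α.map t).source = (α.map (-t)).target := by
  ext x
  constructor
  · intro h
    have h' := α.arrow_neg ⟨h, rfl⟩
    exact h'.2 ▸ (α.map (-t)).map_source h'.1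
  · intro h
    have h' := α.arrow_neg ⟨(α.map (-t)).map_target h, (α.map (-t)).right_inv h⟩
    rw [neg_neg] at h'
    exact h'.1

theorem mem_target_zero (α : PartialAction G X) (x : X) : x ∈ (α.map 0).target := by
  have h := (α.map 0).map_source (x := x) (α.source_zero ▸ Set.mem_univ x)
  rwa [α.zero_apply] at h

theorem symm_zero_apply (α : PartialAction G X) (x : X) : (α.map 0).symm x = x := by
  have h := (α.map 0).left_inv (α.source_zero ▸ Set.mem_univ x)
  rwa [α.zero_apply] at h

end Group

end PartialAction

section Functions

variable {X : Type u} [TopologicalSpace X]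

/-- The ideal `C₀(U)` of `C₀(X)`: functions in `C₀(X)` that vanish outside `U`. -/
def C0On (U : Set X) : Submodule ℂ C₀(X, ℂ) where
  carrier := {f | ∀ x, x ∉ U → f x = 0}
  add_mem' hf hg x hx := by simp [hf x hx, hg x hx]
  zero_mem' x _ := rfl
  smul_mem' c f hf x hx := by simp [hf x hx]

theorem C0On.mul_mem_left {U : Set X} {f : C₀(X, ℂ)} (hf : f ∈ C0On U) (g : C₀(X, ℂ)) :
    f * g ∈ C0On U := fun x hx => by simp [hf x hx]

theorem C0On.star_mem {U : Set X} {f : C₀(X, ℂ)} (hf : f ∈ C0On U) : star f ∈ C0On U :=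
  fun x hx => by simp [hf x hx]

open Classical in
theorem isCompact_transport [T2Space X] (e : OpenPartialHomeomorph X X) (f : C0On e.source)
    {ε : ℝ} (hε : 0 < ε) :
    IsCompact {x | ε ≤ ‖if x ∈ e.target then f.1 (e.symm x) else 0‖} := by
  have hK : IsCompact {x | ε ≤ ‖f.1 x‖} := by
    have h := (zero_at_infty f.1).eventually (Metric.ball_mem_nhds 0 hε)
    obtain ⟨K, hK, hsub⟩ := Filter.mem_cocompact.1 h
    refine hK.of_isClosed_subset (isClosed_le continuous_const f.1.continuous.norm) fun x hx => ?_
    by_contra hxK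
    have h' := hsub hxK
    simp only [Set.mem_ofPred_eq, dist_zero_right] at h' hx
    exact absurd hx (not_le.2 h')
  have hsub : {x | ε ≤ ‖f.1 x‖} ⊆ e.source := fun x hx => by
    by_contra hxs
    rw [Set.mem_ofPred_eq, f.2 x hxs, norm_zero] at hx
    exact absurd hx (not_le.2 hε)
  convert hK.image_of_continuousOn (e.continuousOn.mono hsub) using 1
  ext x
  constructor
  · intro hx
    rw [Set.mem_ofPred_eq] at hx
    split_ifs at hx with h
    · exact ⟨e.symm x, hx, e.right_inv h⟩
    · rw [norm_zero] at hx
      exact absurd hx (not_le.2 hε)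
  · rintro ⟨y, hy, rfl⟩
    rw [Set.mem_ofPred_eq, if_pos (e.map_source (hsub hy)), e.left_inv (hsub hy)]
    exact hy

open Classical in
/-- The isomorphism `f ↦ f ∘ e⁻¹` (extended by `0`) from `C₀(e.source)` to `C₀(e.target)` that is
dual to a partial homeomorphism `e` of `X`. -/
def transport [T2Space X] (e : OpenPartialHomeomorph X X) :
    C0On e.source →ₗ[ℂ] C0On e.target where
  toFun f := ⟨{ toFun := fun x => if x ∈ e.target then f.1 (e.symm x) else 0
                continuous_toFun := by
                  rw [continuous_iff_continuousAt]
                  intro x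
                  by_cases hx : x ∈ e.target
                  · refine ContinuousAt.congr (f.1.continuous.continuousAt.comp
                      (e.symm.continuousAt hx)) ?_
                    filter_upwards [e.open_target.mem_nhds hx] with y hy
                    exact (if_pos hy).symm
                  · rw [ContinuousAt, if_neg hx, Metric.tendsto_nhds]
                    intro ε hε
                    filter_upwards [(isCompact_transport e f hε).isClosed.isOpen_compl.mem_nhds
                      (show x ∈ _ by simp [hx, hε])] with y hy
                    rw [dist_zero_right]
                    exact not_le.1 hy
                zero_at_infty' := by
                  rw [Metric.tendsto_nhds]
                  intro ε hε
                  refine Filter.mem_cocompact.2 ⟨_, isCompact_transport e f hε, fun y hy => ?_⟩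
                  rw [Set.mem_ofPred_eq, dist_zero_right]
                  exact not_le.1 hy }, fun x hx => if_neg hx⟩
  map_add' f g := by
    ext x
    by_cases hx : x ∈ e.target <;> simp [hx]
  map_smul' c f := by
    ext x
    by_cases hx : x ∈ e.target <;> simp [hx]

open Classical in
theorem transport_apply [T2Space X] (e : OpenPartialHomeomorph X X) (f : C0On e.source) (x : X) :
    (transport e f : C₀(X, ℂ)) x = if x ∈ e.target then (f : C₀(X, ℂ)) (e.symm x) else 0 := rfl

end Functions

namespace PartialAction

section CrossedProduct

variable {G : Type w} [AddCommGroup G] {X : Type u} [TopologicalSpace X]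

/-- The ideal `D_n = C₀(X_n)` of `C₀(X)`. -/
def ideal (α : PartialAction G X) (n : G) : Submodule ℂ C₀(X, ℂ) :=
  C0On (α.map n).target

theorem mem_ideal_zero (α : PartialAction G X) (f : C₀(X, ℂ)) : f ∈ α.ideal 0 := fun x hx =>
  absurd (α.mem_target_zero x) hx

variable [T2Space X]

/-- The dual isomorphism `α_n : D_{-n} → D_n`, `f ↦ f ∘ α_n⁻¹`. -/
def dual (α : PartialAction G X) (n : G) : C0On (α.map n).source →ₗ[ℂ] α.ideal n :=
  transport (α.map n)

/-- The inverse `α_{-n} : D_n → D_{-n}` of `dual α n`, `f ↦ f ∘ α_n`. -/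
def dualSymm (α : PartialAction G X) (n : G) : α.ideal n →ₗ[ℂ] C0On (α.map n).source :=
  transport (α.map n).symm

open Classical in
theorem dual_apply (α : PartialAction G X) (n : G) (f : C0On (α.map n).source) (x : X) :
    (α.dual n f : C₀(X, ℂ)) x =
      if x ∈ (α.map n).target then (f : C₀(X, ℂ)) ((α.map n).symm x) else 0 := rfl

open Classical in
theorem dualSymm_apply (α : PartialAction G X) (n : G) (f : α.ideal n) (x : X) :
    (α.dualSymm n f : C₀(X, ℂ)) x =
      if x ∈ (α.map n).source then (f : C₀(X, ℂ)) (α.map n x) else 0 := rfl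

/-- The coefficient `α_n(α_{-n}(f) g) ∈ D_{n+m}` of the product `f Uⁿ · g Uᵐ`. -/
def coeffMul (α : PartialAction G X) {n m : G} (f : α.ideal n) (g : α.ideal m) :
    α.ideal (n + m) :=
  ⟨α.dual n ⟨(α.dualSymm n f : C₀(X, ℂ)) * g, C0On.mul_mem_left (α.dualSymm n f).2 _⟩, by
    intro x hx
    rw [dual_apply]
    split_ifs with h
    · have hm : (α.map n).symm x ∉ (α.map m).target := fun hm => hx (by
        have h' : x ∈ α.map n '' ((α.map n).source ∩ (α.map m).target) :=
          ⟨_, ⟨(α.map n).map_target h, hm⟩, (α.map n).right_inv h⟩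
        rw [α.image_inter_target] at h'
        exact h'.2)
      rw [ZeroAtInftyContinuousMap.mul_apply, g.2 _ hm, mul_zero]
    · rfl⟩

open Classical in
theorem coeffMul_apply (α : PartialAction G X) {n m : G} (f : α.ideal n) (g : α.ideal m) (x : X) :
    (α.coeffMul f g : C₀(X, ℂ)) x = if x ∈ (α.map n).target then
      (f : C₀(X, ℂ)) x * (g : C₀(X, ℂ)) ((α.map n).symm x) else 0 := by
  change (α.dual n _ : C₀(X, ℂ)) x = _
  rw [dual_apply]
  split_ifs with h
  · rw [ZeroAtInftyContinuousMap.mul_apply, dualSymm_apply, if_pos ((α.map n).map_target h),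
      (α.map n).right_inv h]
  · rfl

/-- The coefficient `α_{-n}(f̄) ∈ D_{-n}` of `(f Uⁿ)*`. -/
def coeffStar (α : PartialAction G X) (n : G) : α.ideal n →+ α.ideal (-n) where
  toFun f := ⟨α.dualSymm n ⟨star (f : C₀(X, ℂ)), C0On.star_mem f.2⟩, by
    rw [ideal, ← α.source_neg n]
    exact (α.dualSymm n _).2⟩
  map_zero' := by
    ext x
    simp [dualSymm_apply]
  map_add' f g := by
    ext x
    simp only [dualSymm_apply, Submodule.coe_add, ZeroAtInftyContinuousMap.add_apply,
      ZeroAtInftyContinuousMap.star_apply, star_add]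
    split_ifs <;> simp

open Classical in
theorem coeffStar_apply (α : PartialAction G X) (n : G) (f : α.ideal n) (x : X) :
    (α.coeffStar n f : C₀(X, ℂ)) x =
      if x ∈ (α.map n).source then star ((f : C₀(X, ℂ)) (α.map n x)) else 0 := rfl

instance (α : PartialAction G X) :
    DirectSum.GNonUnitalNonAssocSemiring (fun n => ↥(α.ideal n)) where
  mul := α.coeffMul
  mul_zero f := by ext x; simp [coeffMul_apply]
  zero_mul f := by ext x; simp [coeffMul_apply]
  mul_add f g h := by
    ext x
    simp only [coeffMul_apply, Submodule.coe_add, ZeroAtInftyContinuousMap.add_apply]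
    split_ifs <;> ring
  add_mul f g h := by
    ext x
    simp only [coeffMul_apply, Submodule.coe_add, ZeroAtInftyContinuousMap.add_apply]
    split_ifs <;> ring

/-- The polynomials `∑ f_n Uⁿ` with `f_n ∈ D_n`; the monomial `f Uⁿ` is `DirectSum.of _ n f`.  The
multiplication is the biadditive one with `f Uⁿ · g Uᵐ = α_n(α_{-n}(f) g) Uⁿ⁺ᵐ`. -/
abbrev Poly (α : PartialAction G X) : Type (max u w) := ⨁ n : G, α.ideal n

variable [DecidableEq G]

/-- The monomial `f Uⁿ`. -/
def mono (α : PartialAction G X) (n : G) (f : α.ideal n) : α.Poly :=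
  DirectSum.of (fun n => ↥(α.ideal n)) n f

theorem mono_congr (α : PartialAction G X) {m n : G} (h : m = n) (f : α.ideal m) (g : α.ideal n)
    (hfg : (f : C₀(X, ℂ)) = g) : α.mono m f = α.mono n g := by
  subst h
  rw [Subtype.ext hfg]

theorem mono_mul_mono (α : PartialAction G X) {n m : G} (f : α.ideal n) (g : α.ideal m) :
    α.mono n f * α.mono m g = α.mono (n + m) (α.coeffMul f g) :=
  DirectSum.of_mul_of _ _

/-- The involution of the polynomials, with `(f Uⁿ)* = α_{-n}(f̄) U⁻ⁿ`. -/
instance (α : PartialAction G X) : Star α.Poly where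
  star := DirectSum.toAddMonoid fun n =>
    (DirectSum.of (fun n => ↥(α.ideal n)) (-n)).comp (α.coeffStar n)

theorem star_mono (α : PartialAction G X) {n : G} (f : α.ideal n) :
    star (α.mono n f) = α.mono (-n) (α.coeffStar n f) :=
  DirectSum.toAddMonoid_of _ _ _

/-- The multiplication of polynomials is associative. -/
theorem mono_mul_assoc (α : PartialAction G X) {n m k : G} (f : α.ideal n) (g : α.ideal m) (h : α.ideal k) :
    α.mono n f * α.mono m g * α.mono k h = α.mono n f * (α.mono m g * α.mono k h) := by
  simp only [mono_mul_mono]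
  refine α.mono_congr (add_assoc _ _ _) _ _ ?_
  ext x
  simp only [coeffMul_apply]
  by_cases hx : x ∈ (α.map n).target
  · by_cases hy : (α.map n).symm x ∈ (α.map m).target
    · have a1 : α.Arrow n ((α.map n).symm x) x := ⟨(α.map n).map_target hx, (α.map n).right_inv hx⟩
      have a2 : α.Arrow m ((α.map m).symm ((α.map n).symm x)) ((α.map n).symm x) :=
        ⟨(α.map m).map_target hy, (α.map m).right_inv hy⟩
      have a3 := α.arrow_three a2 a1
      have ht : x ∈ (α.map (n + m)).target := a3.2 ▸ (α.map (n + m)).map_source a3.1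
      have he : (α.map (n + m)).symm x = (α.map m).symm ((α.map n).symm x) := by
        conv_lhs => rw [← a3.2]
        exact (α.map (n + m)).left_inv a3.1
      simp [hx, hy, ht, he, mul_assoc]
    · simp [hx, hy, g.2 _ hy]
  · simp [hx]

/-- The involution of polynomials is antimultiplicative. -/
theorem star_mono_mul_mono (α : PartialAction G X) {n m : G} (f : α.ideal n) (g : α.ideal m) :
    star (α.mono n f * α.mono m g) = star (α.mono m g) * star (α.mono n f) := by
  simp only [mono_mul_mono, star_mono]
  refine α.mono_congr (by abel) _ _ ?_
  ext x
  simp only [coeffMul_apply, coeffStar_apply]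
  have hs : ∀ (k : G) (y : X), y ∈ (α.map k).source ↔ y ∈ (α.map (-k)).target := fun k y => by
    rw [α.source_neg k]
  have hsy : ∀ (k : G) (y : X), y ∈ (α.map k).source → (α.map (-k)).symm y = α.map k y := by
    intro k y hy
    have := α.arrow_neg ⟨hy, rfl⟩
    conv_lhs => rw [← this.2]
    exact (α.map (-k)).left_inv this.1
  by_cases hx : x ∈ (α.map m).source
  · have hx' := (hs m x).1 hx
    have a2 : α.Arrow m x (α.map m x) := ⟨hx, rfl⟩
    by_cases hy : α.map m x ∈ (α.map n).source
    · have a3 := α.arrow_three a2 ⟨hy, rfl⟩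
      have ht : α.map n (α.map m x) ∈ (α.map n).target := (α.map n).map_source hy
      rw [if_pos a3.1, a3.2, if_pos ht, if_pos hx', hsy m x hx, if_pos hx, if_pos hy, (α.map n).left_inv hy]
      simp [mul_comm]
    · rw [if_pos hx', hsy m x hx, if_neg hy, mul_zero]
      split_ifs with h1 h2
      · exfalso
        have a1 : α.Arrow n ((α.map n).symm (α.map (n + m) x)) (α.map (n + m) x) := ⟨(α.map n).map_target h2, (α.map n).right_inv h2⟩
        have := α.arrow_two a2 ⟨h1, rfl⟩
        exact hy this.1
      · simp
      · rfl
  · rw [if_neg (fun h => hx ((hs m x).2 h))]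
    split_ifs with h1 h2
    · have hz : (α.map n).symm (α.map (n + m) x) ∉ (α.map m).target := by
        intro hz
        have a1 : α.Arrow n ((α.map n).symm (α.map (n + m) x)) (α.map (n + m) x) := ⟨(α.map n).map_target h2, (α.map n).right_inv h2⟩
        exact hx (α.arrow_one a1 ⟨h1, rfl⟩).1
      simp [g.2 _ hz]
    · simp
    · rfl

open Classical in
/-- The norm `‖∑ f_n Uⁿ‖_L = ∑ ‖f_n‖`. -/
def normL (α : PartialAction G X) (p : α.Poly) : ℝ :=
  ∑ n ∈ DFinsupp.support p, ‖(p n : C₀(X, ℂ))‖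

/-- A representation of the `*`-algebra of polynomials on a Hilbert space that is continuous for the
norm `‖·‖_L`.  By the GNS construction, Hilbert spaces in the universe of `Poly α` suffice to
realize every `C*`-seminorm on `Poly α`. -/
structure Rep (α : PartialAction G X) where
  /-- The Hilbert space. -/
  H : Type (max u w)
  [normed : NormedAddCommGroup H]
  [inner : InnerProductSpace ℂ H]
  [complete : CompleteSpace H]
  /-- The `*`-homomorphism. -/
  hom : α.Poly →⋆ₙₐ[ℂ] (H →L[ℂ] H)
  continuous : ∃ C : ℝ, ∀ p, ‖hom p‖ ≤ C * α.normL p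

attribute [instance] Rep.normed Rep.inner Rep.complete

/-- A representation restricts to a `*`-homomorphism on `C₀(X) = D_0`. -/
def Rep.diag {α : PartialAction G X} (π : α.Rep) : C₀(X, ℂ) →⋆ₙₐ[ℂ] (π.H →L[ℂ] π.H) where
  toFun f := π.hom (α.mono 0 ⟨f, α.mem_ideal_zero f⟩)
  map_smul' c f := by
    rw [← map_smul]
    exact congrArg π.hom (DirectSum.lof ℂ G (fun n => ↥(α.ideal n)) 0 |>.map_smul c
      ⟨f, α.mem_ideal_zero f⟩)
  map_zero' := by
    rw [← map_zero π.hom]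
    exact congrArg π.hom (map_zero (DirectSum.of (fun n => ↥(α.ideal n)) 0))
  map_add' f g := by
    rw [← map_add]
    exact congrArg π.hom (map_add (DirectSum.of (fun n => ↥(α.ideal n)) 0)
      ⟨f, α.mem_ideal_zero f⟩ ⟨g, α.mem_ideal_zero g⟩)
  map_mul' f g := by
    rw [← map_mul, mono_mul_mono]
    refine congrArg π.hom (α.mono_congr (add_zero 0).symm _ _ ?_)
    ext x
    rw [coeffMul_apply, if_pos (α.mem_target_zero x), symm_zero_apply]
    rfl
  map_star' f := by
    rw [← map_star, star_mono]
    refine congrArg π.hom (α.mono_congr neg_zero.symm _ _ ?_)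
    ext x
    rw [coeffStar_apply, if_pos (α.source_zero ▸ Set.mem_univ x), α.zero_apply]
    rfl

theorem Rep.norm_mono_le {α : PartialAction G X} (π : α.Rep) (n : G) (f : α.ideal n) :
    ‖π.hom (α.mono n f)‖ ≤ ‖(f : C₀(X, ℂ))‖ := by
  have h : α.mono n f * star (α.mono n f) =
      α.mono 0 ⟨(f : C₀(X, ℂ)) * star (f : C₀(X, ℂ)), α.mem_ideal_zero _⟩ := by
    rw [star_mono, mono_mul_mono]
    refine α.mono_congr (add_neg_cancel n) _ _ ?_
    ext x
    rw [coeffMul_apply]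
    split_ifs with hx
    · rw [coeffStar_apply, if_pos ((α.map n).map_target hx), (α.map n).right_inv hx]
      rfl
    · rw [ZeroAtInftyContinuousMap.mul_apply, f.2 x hx, zero_mul]
  have h1 : ‖π.hom (α.mono n f)‖ * ‖π.hom (α.mono n f)‖ ≤
      ‖(f : C₀(X, ℂ))‖ * ‖(f : C₀(X, ℂ))‖ := by
    rw [← CStarRing.norm_self_mul_star, ← CStarRing.norm_self_mul_star (x := (f : C₀(X, ℂ))),
      ← map_star, ← map_mul, h]
    exact NonUnitalStarAlgHom.norm_apply_le π.diag _
  exact abs_le_of_sq_le_sq' (by nlinarith) (norm_nonneg _) |>.2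

theorem Rep.norm_le {α : PartialAction G X} (π : α.Rep) (p : α.Poly) :
    ‖π.hom p‖ ≤ α.normL p := by
  classical
  conv_lhs => rw [← DirectSum.sum_support_of p, map_sum]
  exact (norm_sum_le _ _).trans (Finset.sum_le_sum fun n _ => π.norm_mono_le n _)

/-- The direct sum of all representations of the polynomials.  It takes values in the
`C*`-algebra of bounded families of operators, one on each representation space, with the supremum
norm, so that `‖universalRep α p‖ = sup_π ‖π(p)‖`. -/
def universalRep (α : PartialAction G X) :
    α.Poly →⋆ₙₐ[ℂ] lp (fun π : α.Rep => π.H →L[ℂ] π.H) ∞ where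
  toFun p := ⟨fun π => π.hom p, memℓp_infty ⟨α.normL p, by
    rintro _ ⟨π, rfl⟩
    exact π.norm_le p⟩⟩
  map_smul' c p := by
    ext1
    funext π
    exact map_smul π.hom c p
  map_zero' := by
    ext1
    funext π
    exact map_zero π.hom
  map_add' p q := by
    ext1
    funext π
    exact map_add π.hom p q
  map_mul' p q := by
    ext1
    funext π
    exact map_mul π.hom p q
  map_star' p := by
    ext1
    funext π
    exact map_star π.hom p

/-- The polynomials `∑ f_n Uⁿ` for which all `n` are in `S`. -/
def polyOn (α : PartialAction G X) (S : AddSubmonoid G) : NonUnitalSubalgebra ℂ α.Poly where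
  carrier := {p | ∀ n, n ∉ S → p n = 0}
  add_mem' hp hq n hn := by
    rw [DirectSum.add_apply, hp n hn, hq n hn, add_zero]
  zero_mem' n _ := rfl
  smul_mem' c p hp n hn := by
    rw [DirectSum.smul_apply, hp n hn, smul_zero]
  mul_mem' := by
    classical
    intro p q hp hq k hk
    rw [← DirectSum.sum_support_of p, ← DirectSum.sum_support_of q, Finset.sum_mul_sum,
      DFinsupp.finsetSum_apply]
    refine Finset.sum_eq_zero fun i hi => ?_
    rw [DFinsupp.finsetSum_apply]
    refine Finset.sum_eq_zero fun j hj => ?_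
    rw [DFinsupp.mem_support_iff] at hi hj
    have hi : i ∈ S := by_contra fun h => hi (hp _ h)
    have hj : j ∈ S := by_contra fun h => hj (hq _ h)
    rw [DirectSum.of_mul_of]
    exact DirectSum.of_eq_of_ne _ _ _ fun h => hk (h ▸ S.add_mem hi hj)

/-- The partial crossed product `C₀(X) ×_α G`: the (Hausdorff) completion of the polynomials in the
norm `‖p‖ = sup_π ‖π(p)‖`, realized as the closure of their image under the direct sum of all
representations. -/
def crossedProduct (α : PartialAction G X) :
    NonUnitalSubalgebra ℂ (lp (fun π : α.Rep => π.H →L[ℂ] π.H) ∞) :=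
  ((α.polyOn ⊤).map α.universalRep).topologicalClosure

/-- The analytic crossed product `C₀(X) ×_α S`: the closure in `C₀(X) ×_α G` of the polynomials
`∑ f_n Uⁿ` for which all `n` are in `S`.  (The crossed product is closed in the ambient algebra, so
the closure may be taken there.) -/
def analyticCrossedProduct (α : PartialAction G X) (S : AddSubmonoid G) :
    NonUnitalSubalgebra ℂ (lp (fun π : α.Rep => π.H →L[ℂ] π.H) ∞) :=
  ((α.polyOn S).map α.universalRep).topologicalClosure

theorem analyticCrossedProduct_le (α : PartialAction G X) (S : AddSubmonoid G) :
    α.analyticCrossedProduct S ≤ α.crossedProduct :=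
  closure_mono (Set.image_mono fun _ _ _ hn => absurd trivial hn)

end CrossedProduct

/-- The algebra `C₀(X) ×_α ℤ⁺` of a partial action `α` of `ℤ⁺` on `X`: the analytic crossed product
associated with the extension of `α` to `ℤ` and the cone `ℤ⁺`. -/
abbrev semicrossedProduct {X : Type u} [TopologicalSpace X] [T2Space X] (α : PartialAction ℕ X) :=
  α.extend.analyticCrossedProduct (AddSubmonoid.nonneg ℤ)

end PartialAction

end

/-!
The domain ordering property makes `α_n` the `n`-th power of the partial homeomorphism `α_1`, so a
conjugacy of `α` and `β` is the same as a homeomorphism `τ : X → Y` with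
`α_1(x) = z ↔ β_1(τ x) = τ z`.

*From an isomorphism to a conjugacy.*  The algebra `C₀(X) ×_α ℤ⁺` acts on `ℓ²(X)` by
`(f Uⁿ ξ)(x) = f(x) ξ(α_n⁻¹(x))`, and as the action is free, its matrix coefficients at points of one
orbit pick out single Fourier coefficients: `ε_x : ∑ f_n Uⁿ ↦ f_0(x)` and, if `α_1(y) = x`,
`∑ f_n Uⁿ ↦ f_1(x)` are continuous functionals.  The first kind are all the characters
(`exists_eq_eps`), so a continuous isomorphism induces a homeomorphism `τ` of the spaces.  The second
kind are derivations for the bimodule structure on `ℂ` given by `ε_x` and `ε_y`, and up to inner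
derivations they are the only ones: such a derivation that is not inner exists exactly if
`α_1(y) = x` (`arrow_one_iff`).  As this condition is invariant under isomorphism, `τ` intertwines
`α_1` and `β_1`.  Both classifications rest on `eq_zero_of_not_arrow`: a functional on which `C₀(X)`
acts from the left through `x` and from the right through `y` vanishes on `g Uⁿ` unless
`α_n(y) = x`.

*From a conjugacy to an isomorphism.*  Composition with `τ⁻¹` identifies the polynomials over `α` and
`β`; what has to be compared are the universal norms, which are suprema over Hilbert spaces in the
universes of `X` and `Y`, respectively.  For a representation of the polynomials over `β` and a
vector `η`, the cyclic subspace of `η` has a dense subset as small as the polynomials over `α`, so it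
is isometric to an `ℓ²`-space in the universe of `X`, which carries a representation of the
polynomials over `α` (`Intertwines.exists_rep`).  So composition with `τ⁻¹` does not increase norms,
and by symmetry it is isometric.
-/

noncomputable section

universe u v w

/-! ### Functions vanishing at infinity -/

namespace ZeroAtInftyContinuousMap

variable {X : Type u} [TopologicalSpace X]

theorem norm_le_of_forall {f : C₀(X, ℂ)} {C : ℝ} (hC : 0 ≤ C) (h : ∀ x, ‖f x‖ ≤ C) : ‖f‖ ≤ C := by
  rw [← norm_toBCF_eq_norm]
  exact (BoundedContinuousFunction.norm_le hC).2 h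

theorem norm_apply_le (f : C₀(X, ℂ)) (x : X) : ‖f x‖ ≤ ‖f‖ := by
  rw [← norm_toBCF_eq_norm]
  exact f.toBCF.norm_coe_le_norm x

/-- Elements of `f C₀(X)` approximate `f`: there is an approximate unit for `f` in the ideal
generated by `f`. -/
theorem exists_mul_sub_norm_le (f : C₀(X, ℂ)) {ε : ℝ} (hε : 0 < ε) :
    ∃ k : C₀(X, ℂ), (∀ x, f x = 0 → k x = 0) ∧ ‖k * f - f‖ ≤ ε := by
  have hpos : ∀ z : ℂ, 0 < ‖z‖ ^ 2 + ε ^ 2 := fun z => by positivity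
  -- The function `|f|² / (|f|² + ε²)` works because `ε |f| ≤ |f|² + ε²`.
  let φ : ℂ → ℂ := fun z => ((‖z‖ ^ 2 / (‖z‖ ^ 2 + ε ^ 2) : ℝ) : ℂ)
  have hφ : Continuous φ := Complex.continuous_ofReal.comp
    ((continuous_norm.pow 2).div ((continuous_norm.pow 2).add continuous_const)
      fun z => (hpos z).ne')
  have hφ0 : φ 0 = 0 := by simp [φ]
  refine ⟨⟨⟨fun x => φ (f x), hφ.comp f.continuous⟩,
    (hφ.tendsto' 0 0 hφ0).comp f.zero_at_infty'⟩, fun x hx => ?_, ?_⟩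
  · change φ (f x) = 0
    rw [hx, hφ0]
  · refine norm_le_of_forall hε.le fun x => ?_
    change ‖φ (f x) * f x - f x‖ ≤ ε
    have h1 : φ (f x) * f x - f x =
        -(((ε ^ 2 / (‖f x‖ ^ 2 + ε ^ 2) : ℝ) : ℂ) * f x) := by
      have : (((‖f x‖ ^ 2 / (‖f x‖ ^ 2 + ε ^ 2) : ℝ) : ℂ)) =
          1 - ((ε ^ 2 / (‖f x‖ ^ 2 + ε ^ 2) : ℝ) : ℂ) := by
        rw [← Complex.ofReal_one, ← Complex.ofReal_sub]
        congr 1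
        have := (hpos (f x)).ne'
        field_simp
        ring
      simp only [φ]
      rw [this]
      ring
    rw [h1, norm_neg, norm_mul, Complex.norm_real, Real.norm_of_nonneg (by positivity),
      div_mul_eq_mul_div, div_le_iff₀ (hpos _)]
    have h2 : ε * ‖f x‖ ≤ ‖f x‖ ^ 2 + ε ^ 2 := by
      nlinarith [sq_nonneg (ε - ‖f x‖), norm_nonneg (f x)]
    nlinarith [mul_le_mul_of_nonneg_left h2 hε.le]

variable [LocallyCompactSpace X] [T2Space X]

theorem exists_eq_one_of_mem_open {U : Set X} (hU : IsOpen U) {x : X} (hx : x ∈ U) :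
    ∃ f : C₀(X, ℂ), f x = 1 ∧ ∀ y, y ∉ U → f y = 0 := by
  obtain ⟨f, h1, h0, hc, -⟩ := exists_continuous_one_zero_of_isCompact (isCompact_singleton (x := x))
    hU.isClosed_compl (Set.disjoint_compl_right_iff_subset.2 (Set.singleton_subset_iff.2 hx))
  have hc' : HasCompactSupport fun y => (f y : ℂ) := hc.comp_left (g := ((↑) : ℝ → ℂ)) rfl
  refine ⟨⟨⟨fun y => (f y : ℂ), Complex.continuous_ofReal.comp f.continuous⟩,
    hc'.is_zero_at_infty⟩, ?_, fun y hy => ?_⟩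
  · change ((f x : ℝ) : ℂ) = 1
    rw [h1 rfl]
    simp
  · change ((f y : ℝ) : ℂ) = 0
    rw [h0 hy]
    simp

theorem exists_eq_one (x : X) : ∃ f : C₀(X, ℂ), f x = 1 :=
  (exists_eq_one_of_mem_open isOpen_univ (Set.mem_univ x)).imp fun _ h => h.1

theorem exists_eq_one_eq_zero {x y : X} (h : x ≠ y) : ∃ f : C₀(X, ℂ), f x = 1 ∧ f y = 0 :=
  (exists_eq_one_of_mem_open isOpen_compl_singleton (Set.mem_compl_singleton_iff.2 h)).imp
    fun _ h => ⟨h.1, h.2 y fun h' => h' rfl⟩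

/-- A map into a locally compact Hausdorff space is continuous if its composition with each element
of `C₀` is. -/
theorem continuous_of_continuous_comp {Z : Type*} [TopologicalSpace Z] {σ : Z → X}
    (h : ∀ f : C₀(X, ℂ), Continuous fun z => f (σ z)) : Continuous σ := by
  rw [continuous_iff_continuousAt]
  intro z U hU
  obtain ⟨V, hVU, hV, hz⟩ := mem_nhds_iff.1 hU
  obtain ⟨f, h1, h0⟩ := exists_eq_one_of_mem_open hV hz
  have hne : f (σ z) ≠ 0 := h1 ▸ one_ne_zero
  refine Filter.mem_map.2 ?_
  filter_upwards [(h f).continuousAt.eventually_ne hne] with w hw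
  exact hVU (by_contra fun hw' => hw (h0 _ hw'))

open OnePoint in
/-- Every nonzero character of `C₀(X)` is a point evaluation.  The character extends to
`C(X ∪ {∞})`, where it is the evaluation at a point other than `∞`. -/
theorem exists_eq_eval (χ : C₀(X, ℂ) →ₙₐ[ℂ] ℂ) (hχ : ∃ f, χ f ≠ 0) : ∃ x, ∀ f, χ f = f x := by
  let R : C(OnePoint X, ℂ) → C₀(X, ℂ) := fun F =>
    ⟨⟨fun x => F x - F ∞, (F.continuous.comp continuous_coe).sub continuous_const⟩, by
      rw [← Filter.coclosedCompact_eq_cocompact]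
      exact (((F.continuous.tendsto ∞).comp tendsto_coe_infty).sub_const (F ∞)).trans
        (by rw [sub_self])⟩
  have hR : ∀ F x, R F x = F x - F ∞ := fun F x => rfl
  let χ' : C(OnePoint X, ℂ) →ₐ[ℂ] ℂ :=
    { toFun F := F ∞ + χ (R F)
      map_one' := by
        have : R 1 = 0 := by ext x; simp [hR]
        simp [this]
      map_mul' F G := by
        have : R (F * G) = R F * R G + F ∞ • R G + G ∞ • R F := by
          ext x
          simp [hR]
          ring
        rw [this]
        simp only [map_add, map_mul, _root_.map_smul, ContinuousMap.mul_apply, smul_eq_mul]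
        ring
      map_zero' := by
        have : R 0 = 0 := by ext x; simp [hR]
        simp [this]
      map_add' F G := by
        have : R (F + G) = R F + R G := by
          ext x
          simp [hR]
          ring
        rw [this]
        simp only [map_add, ContinuousMap.add_apply]
        ring
      commutes' c := by
        have : R (algebraMap ℂ _ c) = 0 := by ext x; simp [hR]
        simp [this] }
  obtain ⟨p, hp⟩ := (WeakDual.CharacterSpace.continuousMapEval_bijective (OnePoint X) ℂ).2
    (WeakDual.CharacterSpace.equivAlgHom.symm χ')
  have hp' : ∀ F, F p = F ∞ + χ (R F) := fun F =>
    (congrArg (fun φ : WeakDual.characterSpace ℂ C(OnePoint X, ℂ) => φ F) hp)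
  let E : C₀(X, ℂ) → C(OnePoint X, ℂ) := fun f => continuousMapMk f.toContinuousMap 0 (by
    rw [Filter.coclosedCompact_eq_cocompact]
    exact f.zero_at_infty')
  have hE : ∀ f, χ f = E f p := fun f => by
    have h1 : E f ∞ = 0 := rfl
    have h2 : R (E f) = f := by
      ext x
      rw [hR, h1, sub_zero]
      rfl
    rw [hp', h1, h2, zero_add]
  induction p using OnePoint.rec with
  | infty =>
    obtain ⟨f, hf⟩ := hχ
    exact absurd (hE f) hf
  | coe x => exact ⟨x, hE⟩

end ZeroAtInftyContinuousMap

/-! ### Representations and the algebra generated by the monomials with nonnegative degree -/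

namespace PartialAction

section Generators

variable {X : Type u} [TopologicalSpace X] (a : PartialAction ℤ X)

section OfMono

variable {H : Type u} [NormedAddCommGroup H] [InnerProductSpace ℂ H]
  (m : ∀ n, a.ideal n →ₗ[ℂ] (H →L[ℂ] H))

theorem toModule_mono (n : ℤ) (f : a.ideal n) :
    DirectSum.toModule ℂ ℤ (H →L[ℂ] H) m (a.mono n f) = m n f := by
  rw [mono, ← DirectSum.lof_eq_of ℂ]
  exact DirectSum.toModule_lof (M := fun n => ↥(a.ideal n)) ℂ n f

theorem norm_toModule_le (hnorm : ∀ n (f : a.ideal n), ‖m n f‖ ≤ ‖(f : C₀(X, ℂ))‖) (p : a.Poly) :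
    ‖DirectSum.toModule ℂ ℤ (H →L[ℂ] H) m p‖ ≤ a.normL p := by
  classical
  conv_lhs => rw [← DirectSum.sum_support_of p, map_sum]
  refine (norm_sum_le _ _).trans (Finset.sum_le_sum fun n _ => ?_)
  exact (congrArg norm (a.toModule_mono m n (p n))).le.trans (hnorm n _)

variable [T2Space X]

theorem star_add_poly (p q : a.Poly) : star (p + q) = star p + star q :=
  map_add (DirectSum.toAddMonoid fun n =>
    (DirectSum.of (fun n => ↥(a.ideal n)) (-n)).comp (a.coeffStar n)) p q

theorem star_zero_poly : star (0 : a.Poly) = 0 :=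
  map_zero (DirectSum.toAddMonoid fun n =>
    (DirectSum.of (fun n => ↥(a.ideal n)) (-n)).comp (a.coeffStar n))

theorem toModule_mul
    (hmul : ∀ n k (f : a.ideal n) (g : a.ideal k), m (n + k) (a.coeffMul f g) = m n f * m k g)
    (p q : a.Poly) : DirectSum.toModule ℂ ℤ (H →L[ℂ] H) m (p * q) =
      DirectSum.toModule ℂ ℤ (H →L[ℂ] H) m p * DirectSum.toModule ℂ ℤ (H →L[ℂ] H) m q := by
  induction p using DirectSum.induction_on with
  | zero => rw [zero_mul, map_zero, zero_mul]
  | add p₁ p₂ h₁ h₂ => rw [add_mul, map_add, h₁, h₂, map_add, add_mul]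
  | of n f =>
    induction q using DirectSum.induction_on with
    | zero => rw [mul_zero, map_zero, mul_zero]
    | add q₁ q₂ h₁ h₂ => rw [mul_add, map_add, h₁, h₂, map_add, mul_add]
    | of k g =>
      change DirectSum.toModule ℂ ℤ (H →L[ℂ] H) m (a.mono n f * a.mono k g) =
        DirectSum.toModule ℂ ℤ (H →L[ℂ] H) m (a.mono n f) *
          DirectSum.toModule ℂ ℤ (H →L[ℂ] H) m (a.mono k g)
      rw [mono_mul_mono, toModule_mono, toModule_mono, toModule_mono, hmul]

theorem toModule_star [CompleteSpace H]
    (hstar : ∀ n (f : a.ideal n), m (-n) (a.coeffStar n f) = star (m n f)) (p : a.Poly) :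
    DirectSum.toModule ℂ ℤ (H →L[ℂ] H) m (star p) =
      star (DirectSum.toModule ℂ ℤ (H →L[ℂ] H) m p) := by
  induction p using DirectSum.induction_on with
  | zero => rw [star_zero_poly, map_zero, star_zero]
  | add p₁ p₂ h₁ h₂ => rw [star_add_poly, map_add, h₁, h₂, map_add, star_add]
  | of n f =>
    change DirectSum.toModule ℂ ℤ (H →L[ℂ] H) m (star (a.mono n f)) =
      star (DirectSum.toModule ℂ ℤ (H →L[ℂ] H) m (a.mono n f))
    rw [star_mono, toModule_mono, toModule_mono, hstar]

/-- The representation on `H` with prescribed values `m n f` on the monomials `f Uⁿ`. -/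
def Rep.ofMono [CompleteSpace H]
    (hmul : ∀ n k (f : a.ideal n) (g : a.ideal k), m (n + k) (a.coeffMul f g) = m n f * m k g)
    (hstar : ∀ n (f : a.ideal n), m (-n) (a.coeffStar n f) = star (m n f))
    (hnorm : ∀ n (f : a.ideal n), ‖m n f‖ ≤ ‖(f : C₀(X, ℂ))‖) : a.Rep where
  H := H
  hom :=
    { toFun := DirectSum.toModule ℂ ℤ (H →L[ℂ] H) m
      map_smul' := map_smul _
      map_zero' := map_zero _
      map_add' := map_add _
      map_mul' := a.toModule_mul m hmul
      map_star' := a.toModule_star m hstar }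
  continuous := ⟨1, fun p => (a.norm_toModule_le m hnorm p).trans (one_mul _).ge⟩

end OfMono

variable [T2Space X]

/-- The `C*`-algebra of bounded families of operators, one on each representation space, in which
the crossed products lie. -/
abbrev Ambient : Type _ := lp (fun π : a.Rep => π.H →L[ℂ] π.H) ∞

/-- The algebra `C₀(X) ×_a ℤ⁺` as a type of its own, which keeps instance resolution away from the
construction of the crossed product. -/
def Analytic : Type _ := a.analyticCrossedProduct (AddSubmonoid.nonneg ℤ)

set_option synthInstance.maxHeartbeats 100000 in
instance : NonUnitalNormedRing a.Analytic :=
  inferInstanceAs (NonUnitalNormedRing (a.analyticCrossedProduct (AddSubmonoid.nonneg ℤ)))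

set_option synthInstance.maxHeartbeats 100000 in
instance : Module ℂ a.Analytic :=
  inferInstanceAs (Module ℂ (a.analyticCrossedProduct (AddSubmonoid.nonneg ℤ)))

set_option synthInstance.maxHeartbeats 100000 in
instance : NormedSpace ℂ a.Analytic where
  norm_smul_le c x := norm_smul_le c (x.1 : a.Ambient)

set_option synthInstance.maxHeartbeats 100000 in
instance : CompleteSpace a.Analytic :=
  (NonUnitalSubalgebra.isClosed_topologicalClosure _).completeSpace_coe

set_option synthInstance.maxHeartbeats 100000 in
/-- The element `f Uⁿ`, `n ≥ 0`, of `C₀(X) ×_a ℤ⁺`. -/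
def gen (n : ℤ) (hn : 0 ≤ n) : a.ideal n →ₗ[ℂ] a.Analytic where
  toFun f := ⟨a.universalRep (a.mono n f), subset_closure ⟨a.mono n f, fun _ hk =>
    DirectSum.of_eq_of_ne _ _ _ fun h => hk (h ▸ hn), rfl⟩⟩
  map_add' f g := Subtype.ext ((congrArg a.universalRep
    (map_add (DirectSum.of (fun n => ↥(a.ideal n)) n) f g)).trans (map_add a.universalRep _ _))
  map_smul' c f := Subtype.ext ((congrArg a.universalRep
    (map_smul (DirectSum.lof ℂ ℤ (fun n => ↥(a.ideal n)) n) c f)).trans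
      (map_smul a.universalRep c _))

theorem gen_mul_gen {n m : ℤ} (hn : 0 ≤ n) (hm : 0 ≤ m) (f : a.ideal n) (g : a.ideal m) :
    a.gen n hn f * a.gen m hm g = a.gen (n + m) (add_nonneg hn hm) (a.coeffMul f g) := by
  refine Subtype.ext ?_
  change a.universalRep _ * a.universalRep _ = a.universalRep _
  rw [← map_mul, mono_mul_mono]

/-- The component at a representation `π` of an element of `C₀(X) ×_a ℤ⁺`. -/
def evalRep (π : a.Rep) : a.Analytic →L[ℂ] (π.H →L[ℂ] π.H) :=
  LinearMap.mkContinuous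
    { toFun := fun x => (x.1 : a.Ambient) π
      map_add' := fun _ _ => rfl
      map_smul' := fun _ _ => rfl } 1 fun x => by
    rw [one_mul]
    exact lp.norm_apply_le_norm ENNReal.top_ne_zero (x.1 : a.Ambient) π

theorem evalRep_gen (π : a.Rep) {n : ℤ} (hn : 0 ≤ n) (f : a.ideal n) :
    a.evalRep π (a.gen n hn f) = π.hom (a.mono n f) := rfl

theorem norm_evalRep_le (π : a.Rep) (x : a.Analytic) : ‖a.evalRep π x‖ ≤ ‖x‖ :=
  lp.norm_apply_le_norm ENNReal.top_ne_zero (x.1 : a.Ambient) π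

theorem norm_le_of_evalRep {x : a.Analytic} {C : ℝ} (hC : 0 ≤ C)
    (h : ∀ π : a.Rep, ‖a.evalRep π x‖ ≤ C) : ‖x‖ ≤ C :=
  lp.norm_le_of_forall_le hC h

theorem norm_gen_le {n : ℤ} (hn : 0 ≤ n) (f : a.ideal n) : ‖a.gen n hn f‖ ≤ ‖(f : C₀(X, ℂ))‖ :=
  a.norm_le_of_evalRep (norm_nonneg _) fun π => π.norm_mono_le n f

/-- A closed property that is stable under sums and holds for the elements `f Uⁿ`, holds on all of
`C₀(X) ×_a ℤ⁺`. -/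
theorem analytic_induction {p : a.Analytic → Prop} (hc : IsClosed {x | p x})
    (hadd : ∀ x y, p x → p y → p (x + y)) (hgen : ∀ n hn f, p (a.gen n hn f)) (x : a.Analytic) :
    p x := by
  classical
  have hcl : IsClosed (Subtype.val '' {x : a.Analytic | p x} : Set a.Ambient) :=
    (NonUnitalSubalgebra.isClosed_topologicalClosure _).isClosedEmbedding_subtypeVal.isClosedMap
      _ hc
  have hsub : a.universalRep '' (a.polyOn (AddSubmonoid.nonneg ℤ) : Set a.Poly) ⊆
      Subtype.val '' {x : a.Analytic | p x} := by
    rintro _ ⟨q, hq, rfl⟩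
    have hsum : ∀ s : Finset ℤ, (∀ n ∈ s, 0 ≤ n) → ∃ y : a.Analytic, p y ∧
        (y.1 : a.Ambient) = a.universalRep (∑ n ∈ s, a.mono n (q n)) := by
      intro s
      induction s using Finset.induction_on with
      | empty =>
        intro _
        refine ⟨a.gen 0 le_rfl 0, hgen _ _ _, ?_⟩
        rw [map_zero, Finset.sum_empty, map_zero]
        rfl
      | insert n s hns ih =>
        intro hs
        obtain ⟨y, hy, hy'⟩ := ih fun k hk => hs k (Finset.mem_insert_of_mem hk)
        refine ⟨a.gen n (hs n (Finset.mem_insert_self _ _)) (q n) + y,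
          hadd _ _ (hgen _ _ _) hy, ?_⟩
        rw [Finset.sum_insert hns, map_add, ← hy']
        rfl
    obtain ⟨y, hy, hy'⟩ := hsum (DFinsupp.support q) fun n hn =>
      by_contra fun h => DFinsupp.mem_support_iff.1 hn (hq n h)
    refine ⟨y, hy, hy'.trans (congrArg _ (DirectSum.sum_support_of q))⟩
  obtain ⟨y, hy, hyx⟩ := closure_minimal hsub hcl x.2
  exact Subtype.ext hyx ▸ hy

end Generators
end PartialAction

/-! ### The representation on `ℓ²(X)` and its matrix coefficients -/

/-- The operator `(T ξ)(x) = f(x) ξ(σ(x))` on `ℓ²(X)`, for a function `f ∈ C₀(X)` and a map `σ` that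
is injective where `f ≠ 0`. -/
def weightedComp {X : Type u} [TopologicalSpace X] (f : C₀(X, ℂ)) (σ : X → X)
    (hσ : Set.InjOn σ {x | f x ≠ 0}) :
    lp (fun _ : X => ℂ) 2 →L[ℂ] lp (fun _ : X => ℂ) 2 :=
  have h2 : (2 : ℝ≥0∞).toReal = 2 := by norm_num
  have key : ∀ (ξ : lp (fun _ : X => ℂ) 2) (s : Finset X),
      ∑ x ∈ s, ‖f x * ξ (σ x)‖ ^ (2 : ℝ≥0∞).toReal ≤ (‖f‖ * ‖ξ‖) ^ (2 : ℝ≥0∞).toReal := by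
    classical
    intro ξ s
    have hle : ∀ x ∈ s, ‖f x * ξ (σ x)‖ ^ (2 : ℝ≥0∞).toReal ≤
        if f x ≠ 0 then ‖f‖ ^ (2 : ℝ≥0∞).toReal * ‖ξ (σ x)‖ ^ (2 : ℝ≥0∞).toReal else 0 := by
      intro x _
      split_ifs with h
      · rw [norm_mul, Real.mul_rpow (norm_nonneg _) (norm_nonneg _)]
        gcongr
        exact f.norm_apply_le x
      · rw [not_not.1 h, zero_mul, norm_zero, h2, Real.zero_rpow two_ne_zero]
    refine (Finset.sum_le_sum hle).trans ?_
    rw [← Finset.sum_filter, ← Finset.mul_sum, Real.mul_rpow (norm_nonneg _) (norm_nonneg _)]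
    have hinj : Set.InjOn σ (s.filter fun x => f x ≠ 0) :=
      hσ.mono fun x hx => (Finset.mem_filter.1 hx).2
    rw [← Finset.sum_image (f := fun y => ‖ξ y‖ ^ (2 : ℝ≥0∞).toReal) hinj]
    gcongr
    exact lp.sum_rpow_le_norm_rpow (by norm_num) ξ _
  LinearMap.mkContinuous
    { toFun := fun ξ => ⟨fun x => f x * ξ (σ x), memℓp_gen' (key ξ)⟩
      map_add' := fun ξ η => by
        ext x
        exact mul_add _ _ _
      map_smul' := fun c ξ => by
        ext x
        exact mul_left_comm _ _ _ } ‖f‖ fun ξ =>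
    lp.norm_le_of_forall_sum_le (by norm_num) (by positivity) (key ξ)

theorem norm_weightedComp_le {X : Type u} [TopologicalSpace X] (f : C₀(X, ℂ)) (σ : X → X)
    (hσ : Set.InjOn σ {x | f x ≠ 0}) : ‖weightedComp f σ hσ‖ ≤ ‖f‖ :=
  by
  unfold weightedComp
  exact LinearMap.mkContinuous_norm_le _ (norm_nonneg _) _

namespace PartialAction

section Group

variable {G : Type w} [AddCommGroup G] {X : Type u} [TopologicalSpace X] (a : PartialAction G X)

theorem arrow_of_mem_target {n : G} {x : X} (hx : x ∈ (a.map n).target) :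
    a.Arrow n ((a.map n).symm x) x := ⟨(a.map n).map_target hx, (a.map n).right_inv hx⟩

theorem Arrow.mem_target {M : Type w} [AddMonoid M] {a : PartialAction M X} {n : M} {x y : X}
    (h : a.Arrow n x y) : y ∈ (a.map n).target := h.2 ▸ (a.map n).map_source h.1

theorem Arrow.symm_apply {M : Type w} [AddMonoid M] {a : PartialAction M X} {n : M} {x y : X}
    (h : a.Arrow n x y) : (a.map n).symm y = x := by
  rw [← h.2, (a.map n).left_inv h.1]

theorem arrow_zero (x : X) : a.Arrow 0 x x :=
  ⟨a.source_zero ▸ Set.mem_univ x, a.zero_apply x⟩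

theorem symm_neg_apply {n : G} {x : X} (hx : x ∈ (a.map n).source) :
    (a.map (-n)).symm x = a.map n x :=
  (a.arrow_neg (x := x) ⟨hx, rfl⟩).symm_apply

end Group

section RegularRep

variable {X : Type u} [TopologicalSpace X] (a : PartialAction ℤ X)

/-- The operator on `ℓ²(X)` by which `f Uⁿ` acts: `(f Uⁿ ξ)(x) = f(x) ξ(α_n⁻¹(x))`. -/
def regularMono (n : ℤ) : a.ideal n →ₗ[ℂ]
    (lp (fun _ : X => ℂ) 2 →L[ℂ] lp (fun _ : X => ℂ) 2) where
  toFun f := weightedComp f (a.map n).symm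
    ((a.map n).symm.injOn.mono fun x hx => by_contra fun h => hx (f.2 x h))
  map_add' f g := by
    ext ξ x
    exact add_mul _ _ _
  map_smul' c f := by
    ext ξ x
    exact mul_assoc _ _ _

theorem regularMono_apply (n : ℤ) (f : a.ideal n) (ξ : lp (fun _ : X => ℂ) 2) (x : X) :
    a.regularMono n f ξ x = (f : C₀(X, ℂ)) x * ξ ((a.map n).symm x) := rfl

variable [T2Space X]

theorem regularMono_mul (n k : ℤ) (f : a.ideal n) (g : a.ideal k) :
    a.regularMono (n + k) (a.coeffMul f g) = a.regularMono n f * a.regularMono k g := by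
  ext ξ x
  change _ = a.regularMono n f (a.regularMono k g ξ) x
  rw [regularMono_apply, regularMono_apply, regularMono_apply, coeffMul_apply]
  split_ifs with hx
  · by_cases hy : (a.map n).symm x ∈ (a.map k).target
    · rw [(a.arrow_three (a.arrow_of_mem_target hy) (a.arrow_of_mem_target hx)).symm_apply,
        mul_assoc]
    · rw [g.2 _ hy]
      ring
  · rw [f.2 x hx]
    ring

theorem regularMono_star (n : ℤ) (f : a.ideal n) :
    a.regularMono (-n) (a.coeffStar n f) = star (a.regularMono n f) := by
  rw [ContinuousLinearMap.star_eq_adjoint, ContinuousLinearMap.eq_adjoint_iff]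
  intro ξ η
  rw [lp.inner_eq_tsum, lp.inner_eq_tsum]
  -- Both inner products are sums over orbit arrows `x ↦ α_n(x)`, indexed by source and by target.
  rw [← tsum_subtype_eq_of_support_subset (s := (a.map n).source),
    ← tsum_subtype_eq_of_support_subset (s := (a.map n).target)]
  · rw [← (a.map n).toPartialEquiv.toEquiv.tsum_eq]
    refine tsum_congr fun x => ?_
    have hx : (x : X) ∈ (a.map n).source := x.2
    change inner ℂ (a.regularMono (-n) (a.coeffStar n f) ξ x) (η x) =
      inner ℂ (ξ (a.map n x)) (a.regularMono n f η (a.map n x))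
    rw [regularMono_apply, regularMono_apply, coeffStar_apply, if_pos hx, a.symm_neg_apply hx,
      (a.map n).left_inv hx]
    simp only [RCLike.inner_apply, map_mul, RCLike.star_def, RCLike.conj_conj]
    ring
  · intro x hx
    by_contra hx'
    refine hx ?_
    simp only [regularMono_apply, f.2 x hx', zero_mul, inner_zero_right]
  · intro x hx
    by_contra hx'
    refine hx ?_
    simp only [regularMono_apply, coeffStar_apply, if_neg hx', zero_mul, inner_zero_left]

/-- The representation of the partial crossed product on `ℓ²(X)`. -/
def regularRep : a.Rep :=
  Rep.ofMono a a.regularMono a.regularMono_mul a.regularMono_star fun _ f =>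
    norm_weightedComp_le (f : C₀(X, ℂ)) _ ((a.map _).symm.injOn.mono fun x hx =>
      by_contra fun h => hx (f.2 x h))

/-- The action of `C₀(X) ×_a ℤ⁺` on `ℓ²(X)`. -/
def regularEval : a.Analytic →L[ℂ] (lp (fun _ : X => ℂ) 2 →L[ℂ] lp (fun _ : X => ℂ) 2) :=
  a.evalRep a.regularRep

theorem regularEval_gen {n : ℤ} (hn : 0 ≤ n) (f : a.ideal n) :
    a.regularEval (a.gen n hn f) = a.regularMono n f :=
  a.toModule_mono a.regularMono n f

theorem norm_regularEval_le (b : a.Analytic) : ‖a.regularEval b‖ ≤ ‖b‖ :=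
  a.norm_evalRep_le a.regularRep b

open Classical in
/-- The matrix coefficient `⟨T δ_y, δ_x⟩` of an element of `C₀(X) ×_a ℤ⁺` in the representation on
`ℓ²(X)`. -/
def coef (x y : X) : a.Analytic →L[ℂ] ℂ :=
  (lp.evalCLM ℂ (fun _ : X => ℂ) 2 x).comp
    ((ContinuousLinearMap.apply ℂ (lp (fun _ : X => ℂ) 2) (lp.single 2 y (1 : ℂ))).comp
      a.regularEval)

open Classical in
theorem coef_gen (x y : X) {n : ℤ} (hn : 0 ≤ n) (f : a.ideal n) :
    a.coef x y (a.gen n hn f) = if (a.map n).symm x = y then (f : C₀(X, ℂ)) x else 0 := by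
  change a.regularEval (a.gen n hn f) (lp.single 2 y (1 : ℂ)) x = _
  rw [regularEval_gen, regularMono_apply, lp.single_apply]
  split_ifs with hxy
  · subst hxy
    simp
  · simp [hxy]

theorem norm_coef_le (x y : X) (b : a.Analytic) : ‖a.coef x y b‖ ≤ ‖b‖ := by
  classical
  refine (lp.norm_apply_le_norm two_ne_zero
    (a.regularEval b (lp.single 2 y (1 : ℂ))) x).trans ?_
  refine ((a.regularEval b).le_opNorm _).trans ?_
  rw [lp.norm_single (by norm_num), norm_one, mul_one]
  exact a.norm_regularEval_le b

end RegularRep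
end PartialAction

/-! ### Characters and point derivations -/

namespace PartialAction

section PointFunctionals

variable {X : Type u} [TopologicalSpace X] (a : PartialAction ℤ X)

theorem mul_mem_ideal {n : ℤ} (f : C₀(X, ℂ)) (g : a.ideal n) : f * g ∈ a.ideal n := fun x hx => by
  rw [ZeroAtInftyContinuousMap.mul_apply, g.2 x hx, mul_zero]

variable [T2Space X]

/-- The character `∑ f_n Uⁿ ↦ f_0(x)` of `C₀(X) ×_a ℤ⁺`, for a free action `a`.  It is defined as a
diagonal matrix coefficient; without freeness it need not be a character. -/
def eps (x : X) : a.Analytic →L[ℂ] ℂ := a.coef x x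

/-- The inclusion of `C₀(X)` in `C₀(X) ×_a ℤ⁺`. -/
def inc : C₀(X, ℂ) →ₗ[ℂ] a.Analytic :=
  (a.gen 0 le_rfl).comp
    ({ toFun f := ⟨f, a.mem_ideal_zero f⟩
       map_add' _ _ := rfl
       map_smul' _ _ := rfl } : C₀(X, ℂ) →ₗ[ℂ] a.ideal 0)

theorem inc_apply (f : C₀(X, ℂ)) : a.inc f = a.gen 0 le_rfl ⟨f, a.mem_ideal_zero f⟩ := rfl

theorem gen_congr {m n : ℤ} (h : m = n) (hm : 0 ≤ m) (hn : 0 ≤ n) {f : a.ideal m} {g : a.ideal n}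
    (hfg : (f : C₀(X, ℂ)) = g) : a.gen m hm f = a.gen n hn g := by
  subst h
  rw [Subtype.ext hfg]

theorem inc_mul_gen {n : ℤ} (hn : 0 ≤ n) (f : C₀(X, ℂ)) (g : a.ideal n) :
    a.inc f * a.gen n hn g = a.gen n hn ⟨f * g, a.mul_mem_ideal f g⟩ := by
  rw [inc_apply, gen_mul_gen]
  refine a.gen_congr (zero_add n) _ _ ?_
  ext x
  rw [coeffMul_apply, if_pos (a.mem_target_zero x), a.symm_zero_apply,
    ZeroAtInftyContinuousMap.mul_apply]

theorem inc_mul_inc (f g : C₀(X, ℂ)) : a.inc f * a.inc g = a.inc (f * g) :=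
  a.inc_mul_gen le_rfl f ⟨g, a.mem_ideal_zero g⟩

theorem coeffMul_mem {n : ℤ} (f : a.ideal n) (g : C₀(X, ℂ)) :
    (a.coeffMul f ⟨g, a.mem_ideal_zero g⟩ : C₀(X, ℂ)) ∈ a.ideal n := fun x hx => by
  rw [coeffMul_apply, if_neg hx]

theorem gen_mul_inc {n : ℤ} (hn : 0 ≤ n) (f : a.ideal n) (g : C₀(X, ℂ)) :
    a.gen n hn f * a.inc g = a.gen n hn ⟨_, a.coeffMul_mem f g⟩ := by
  rw [inc_apply, gen_mul_gen]
  exact a.gen_congr (add_zero n) _ _ rfl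

/-- For points of one orbit of a free action, the matrix coefficient is evaluation of one Fourier
coefficient, as at most one power of the action moves `y` to `x`. -/
theorem coef_gen_of_arrow (ha : a.IsFree) {x y : X} {k : ℤ} (h : a.Arrow k y x) {n : ℤ} (hn : 0 ≤ n)
    (f : a.ideal n) : a.coef x y (a.gen n hn f) = if n = k then (f : C₀(X, ℂ)) x else 0 := by
  classical
  rw [coef_gen]
  by_cases hnk : n = k
  · subst hnk
    rw [if_pos rfl, if_pos h.symm_apply]
  · rw [if_neg hnk]
    split_ifs with hx
    · refine f.2 x fun hxt => hnk ?_
      have h' : a.Arrow (n - k + k) y x := by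
        rw [sub_add_cancel]
        exact hx ▸ a.arrow_of_mem_target hxt
      have h'' := a.arrow_two h h'
      exact sub_eq_zero.1 (ha _ x h''.1 h''.2)
    · rfl

theorem eps_gen (ha : a.IsFree) (x : X) {n : ℤ} (hn : 0 ≤ n) (f : a.ideal n) :
    a.eps x (a.gen n hn f) = if n = 0 then (f : C₀(X, ℂ)) x else 0 :=
  a.coef_gen_of_arrow ha (a.arrow_zero x) hn f

theorem eps_inc (ha : a.IsFree) (x : X) (f : C₀(X, ℂ)) : a.eps x (a.inc f) = f x := by
  rw [inc_apply, eps_gen a ha, if_pos rfl]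

/-- Continuous linear functionals agree if they agree on the elements `f Uⁿ`. -/
theorem functional_ext {K L : a.Analytic →L[ℂ] ℂ}
    (h : ∀ n (hn : 0 ≤ n) f, K (a.gen n hn f) = L (a.gen n hn f)) (b : a.Analytic) : K b = L b := by
  refine a.analytic_induction (p := fun b => K b = L b) (isClosed_eq K.continuous L.continuous)
    (fun x y hx hy => ?_) h b
  rw [map_add, map_add, hx, hy]

/-- Identities `D(bc) = E(b) L(c) + E'(b) L'(c)` between continuous functionals, such as
multiplicativity and the Leibniz rule, need only be checked on the elements `f Uⁿ`. -/
theorem derivation_of_gen {D E L E' L' : a.Analytic →L[ℂ] ℂ}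
    (h : ∀ n (hn : 0 ≤ n) f m (hm : 0 ≤ m) g, D (a.gen n hn f * a.gen m hm g) =
      E (a.gen n hn f) * L (a.gen m hm g) + E' (a.gen n hn f) * L' (a.gen m hm g))
    (b c : a.Analytic) : D (b * c) = E b * L c + E' b * L' c := by
  refine a.analytic_induction
    (p := fun b => D (b * c) = E b * L c + E' b * L' c)
    (isClosed_eq (D.continuous.comp (continuous_mul_const c)) (by fun_prop))
    (fun x y hx hy => ?_) (fun n hn f => ?_) b
  · rw [add_mul, map_add, hx, hy, map_add, map_add]
    ring
  · refine a.analytic_induction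
      (p := fun c => D (a.gen n hn f * c) = E (a.gen n hn f) * L c + E' (a.gen n hn f) * L' c)
      (isClosed_eq (D.continuous.comp (continuous_const_mul _)) (by fun_prop))
      (fun x y hx hy => ?_) (fun m hm g => h n hn f m hm g) c
    rw [mul_add, map_add, hx, hy, map_add, map_add]
    ring

theorem eps_mul (ha : a.IsFree) (x : X) (b c : a.Analytic) :
    a.eps x (b * c) = a.eps x b * a.eps x c := by
  have := a.derivation_of_gen (D := a.eps x) (E := a.eps x) (L := a.eps x) (E' := 0) (L' := 0)
    (fun n hn f m hm g => ?_) b c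
  · simpa using this
  · rw [gen_mul_gen, eps_gen a ha, eps_gen a ha, eps_gen a ha]
    simp only [_root_.zero_apply, mul_zero, add_zero]
    by_cases h1 : n = 0
    · subst h1
      by_cases h2 : m = 0
      · subst h2
        simp [coeffMul_apply, a.mem_target_zero x, a.symm_zero_apply]
      · simp [h2]
    · rw [if_neg h1, zero_mul, if_neg (by omega)]

/-- The continuous functionals `δ` with `δ(bc) = ε_x(b) δ(c) + δ(b) ε_y(c)`. -/
def IsPointDerivation (x y : X) (δ : a.Analytic →L[ℂ] ℂ) : Prop :=
  ∀ b c, δ (b * c) = a.eps x b * δ c + δ b * a.eps y c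

/-- For an orbit arrow `y ↦ α_1(y) = x`, the functional `∑ f_n Uⁿ ↦ f_1(x)` is a point
derivation. -/
theorem isPointDerivation_coef (ha : a.IsFree) {x y : X} (h : a.Arrow 1 y x) :
    a.IsPointDerivation x y (a.coef x y) := by
  refine a.derivation_of_gen fun n hn f m hm g => ?_
  rw [gen_mul_gen, coef_gen_of_arrow a ha h, coef_gen_of_arrow a ha h, coef_gen_of_arrow a ha h,
    eps_gen a ha, eps_gen a ha, coeffMul_apply]
  by_cases h1 : n = 0
  · subst h1
    simp [a.mem_target_zero x, a.symm_zero_apply]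
  · rw [if_neg h1, zero_mul, zero_add]
    by_cases h2 : m = 0
    · subst h2
      by_cases h3 : n = 1
      · subst h3
        simp [h.mem_target, h.symm_apply]
      · simp [h3]
    · rw [if_neg h2, mul_zero, if_neg (by omega)]

/-- A continuous functional vanishes on `g Uⁿ` if it vanishes on `kg Uⁿ` for all `k ∈ D_n`, since `g`
is a limit of such products `kg`. -/
theorem eq_zero_of_inc_mul (L : a.Analytic →L[ℂ] ℂ) {n : ℤ} (hn : 0 ≤ n) (g : a.ideal n)
    (h : ∀ k ∈ a.ideal n, L (a.inc k * a.gen n hn g) = 0) : L (a.gen n hn g) = 0 := by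
  refine norm_le_zero_iff.1 (le_of_forall_pos_le_add fun ε hε => ?_)
  obtain ⟨k, hk0, hk⟩ := (g : C₀(X, ℂ)).exists_mul_sub_norm_le
    (show 0 < ε / (‖L‖ + 1) by positivity)
  have h1 : L (a.gen n hn g) = -L (a.inc k * a.gen n hn g - a.gen n hn g) := by
    rw [map_sub, h k fun x hx => hk0 x (g.2 x hx), zero_sub, neg_neg]
  have h2 : ‖a.inc k * a.gen n hn g - a.gen n hn g‖ ≤ ε / (‖L‖ + 1) := by
    rw [inc_mul_gen, ← map_sub]
    exact (a.norm_gen_le hn _).trans hk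
  rw [h1, norm_neg, zero_add]
  calc _ ≤ ‖L‖ * ‖a.inc k * a.gen n hn g - a.gen n hn g‖ := L.le_opNorm _
    _ ≤ (‖L‖ + 1) * (ε / (‖L‖ + 1)) := by gcongr; linarith
    _ = ε := by field_simp

variable [LocallyCompactSpace X]

/-- A functional on which `C₀(X)` acts from the left through `x` and from the right through `y`
vanishes on `g Uⁿ` unless `α_n(y) = x`. -/
theorem eq_zero_of_not_arrow {L : a.Analytic →L[ℂ] ℂ} {x y : X}
    (hl : ∀ f b, L (a.inc f * b) = f x * L b) (hr : ∀ f b, L (b * a.inc f) = L b * f y)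
    {n : ℤ} (hn : 0 ≤ n) (hxy : ¬ a.Arrow n y x) (g : a.ideal n) : L (a.gen n hn g) = 0 := by
  refine a.eq_zero_of_inc_mul L hn g fun k hk => ?_
  by_cases hx : x ∈ (a.map n).target
  · have hne : (a.map n).symm x ≠ y := fun h => hxy (h ▸ a.arrow_of_mem_target hx)
    obtain ⟨f, hf1, hf0⟩ := ZeroAtInftyContinuousMap.exists_eq_one_eq_zero hne
    -- `k g Uⁿ f = h g Uⁿ` with `h = k (f ∘ α_n⁻¹)`; the left side is killed by `f(y) = 0`, and
    -- `h(x) = k(x)`.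
    set h : C₀(X, ℂ) := (a.coeffMul ⟨k, hk⟩ ⟨f, a.mem_ideal_zero f⟩ : C₀(X, ℂ)) with hh
    have h1 : a.inc h * a.gen n hn g = a.inc k * a.gen n hn g * a.inc f := by
      rw [inc_mul_gen, inc_mul_gen, gen_mul_inc]
      refine a.gen_congr rfl _ _ ?_
      ext z
      simp only [hh, ZeroAtInftyContinuousMap.mul_apply, coeffMul_apply]
      split_ifs <;> ring
    have h2 : h x = k x := by
      rw [hh, coeffMul_apply, if_pos hx, hf1, mul_one]
    rw [hl, ← h2, ← hl, h1, hr, hf0, mul_zero]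
  · rw [hl, hk x hx, zero_mul]

/-- For a free action, the continuous characters of `C₀(X) ×_a ℤ⁺` are the functionals `ε_x`. -/
theorem exists_eq_eps (ha : a.IsFree) (χ : a.Analytic →L[ℂ] ℂ) (hmul : ∀ b c, χ (b * c) = χ b * χ c)
    (hχ : ∃ b, χ b ≠ 0) : ∃ x, ∀ b, χ b = a.eps x b := by
  let χ₀ : C₀(X, ℂ) →ₙₐ[ℂ] ℂ :=
    { toFun f := χ (a.inc f)
      map_smul' c f := (congrArg χ (map_smul a.inc c f)).trans (map_smul χ c _)
      map_zero' := (congrArg χ (map_zero a.inc)).trans (map_zero χ)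
      map_add' f g := (congrArg χ (map_add a.inc f g)).trans (map_add χ _ _)
      map_mul' f g := by rw [← hmul, inc_mul_inc] }
  have hχ₀ : ∃ f, χ₀ f ≠ 0 := by
    by_contra! h0
    obtain ⟨b, hb⟩ := hχ
    refine hb (a.functional_ext (L := 0) (fun n hn g => a.eq_zero_of_inc_mul χ hn g fun k _ => ?_) b)
    rw [hmul, show χ (a.inc k) = 0 from h0 k, zero_mul]
  obtain ⟨x, hx⟩ := ZeroAtInftyContinuousMap.exists_eq_eval χ₀ hχ₀
  have hx' : ∀ f, χ (a.inc f) = f x := hx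
  refine ⟨x, a.functional_ext fun n hn g => ?_⟩
  rw [eps_gen a ha]
  split_ifs with h
  · subst h
    exact hx' g
  · refine a.eq_zero_of_not_arrow (x := x) (y := x) (fun f b => ?_) (fun f b => ?_) hn
      (fun h' => h (ha n x h'.1 h'.2)) g
    · rw [hmul, hx']
    · rw [hmul, hx']

theorem eps_injective (ha : a.IsFree) {x y : X} (h : ∀ b, a.eps x b = a.eps y b) : x = y := by
  by_contra hxy
  obtain ⟨f, h1, h0⟩ := ZeroAtInftyContinuousMap.exists_eq_one_eq_zero hxy
  have := h (a.inc f)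
  rw [eps_inc a ha, eps_inc a ha, h1, h0] at this
  exact one_ne_zero this

/-- Away from orbit arrows of degree one, a point derivation that vanishes on `C₀(X)` is zero.  Because
of `X_n ⊆ X_1`, every `g Uⁿ` with `n ≥ 2` is a limit of products `k U · g' Uⁿ⁻¹`, and on these the
derivation vanishes since `ε_x` and `ε_y` do so on both factors. -/
theorem isPointDerivation_eq_zero (ha : a.IsFree)
    (hd : ∀ n : ℤ, 1 ≤ n → (a.map n).target ⊆ (a.map 1).target) {x y : X} (hxy : ¬ a.Arrow 1 y x)
    {δ : a.Analytic →L[ℂ] ℂ} (hδ : a.IsPointDerivation x y δ) (h0 : ∀ f, δ (a.inc f) = 0)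
    (b : a.Analytic) : δ b = 0 := by
  have hl : ∀ f b, δ (a.inc f * b) = f x * δ b := fun f b => by
    rw [hδ, h0, zero_mul, add_zero, eps_inc a ha]
  have hr : ∀ f b, δ (b * a.inc f) = δ b * f y := fun f b => by
    rw [hδ, h0, mul_zero, zero_add, eps_inc a ha]
  refine a.functional_ext (L := 0) (fun n hn g => ?_) b
  rw [_root_.zero_apply]
  obtain rfl | rfl | h2 : n = 0 ∨ n = 1 ∨ 2 ≤ n := by omega
  · exact h0 g
  · exact a.eq_zero_of_not_arrow hl hr hn hxy g
  · have h1 : (a.map n).target ⊆ (a.map 1).target := hd n (by omega)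
    refine a.eq_zero_of_inc_mul δ hn g fun k hk => ?_
    let g₁ : a.ideal 1 := ⟨g, fun z hz => g.2 z fun hz' => hz (h1 hz')⟩
    have hg' : (a.dualSymm 1 g₁ : C₀(X, ℂ)) ∈ a.ideal (n - 1) := by
      intro z hz
      rw [dualSymm_apply]
      split_ifs with hz1
      · refine g.2 _ fun hz' => hz ?_
        have h' : a.Arrow (1 + (n - 1)) ((a.map n).symm (a.map 1 z)) (a.map 1 z) := by
          rw [add_sub_cancel]
          exact a.arrow_of_mem_target hz'
        exact (a.arrow_one ⟨hz1, rfl⟩ h').mem_target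
      · rfl
    have hprod : a.inc k * a.gen n hn g =
        a.gen 1 zero_le_one ⟨k, fun z hz => hk z fun hz' => hz (h1 hz')⟩ *
          a.gen (n - 1) (by omega) ⟨_, hg'⟩ := by
      rw [inc_mul_gen, gen_mul_gen]
      refine a.gen_congr (by omega) _ _ ?_
      ext z
      rw [coeffMul_apply]
      split_ifs with hz
      · rw [ZeroAtInftyContinuousMap.mul_apply, dualSymm_apply, if_pos ((a.map 1).map_target hz),
          (a.map 1).right_inv hz]
      · rw [ZeroAtInftyContinuousMap.mul_apply, hk z fun hz' => hz (h1 hz'), zero_mul]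
    rw [hprod, hδ, eps_gen a ha, eps_gen a ha, if_neg one_ne_zero, if_neg (by omega), zero_mul,
      mul_zero, add_zero]

/-- The orbit arrows `α_1(y) = x` are detected by the point derivations at `(x, y)` that are not
inner. -/
theorem arrow_one_iff (ha : a.IsFree)
    (hd : ∀ n : ℤ, 1 ≤ n → (a.map n).target ⊆ (a.map 1).target) {x y : X} :
    a.Arrow 1 y x ↔ x ≠ y ∧ ∃ δ, a.IsPointDerivation x y δ ∧
      ¬ ∃ c : ℂ, ∀ b, δ b = c * (a.eps x b - a.eps y b) := by
  constructor
  · intro h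
    have hne : x ≠ y := fun h' => by
      subst h'
      exact one_ne_zero (ha 1 x h.1 h.2)
    refine ⟨hne, a.coef x y, a.isPointDerivation_coef ha h, ?_⟩
    rintro ⟨c, hc⟩
    obtain ⟨f, hf1, hf0⟩ := ZeroAtInftyContinuousMap.exists_eq_one_eq_zero hne
    have h1 := hc (a.inc f)
    rw [eps_inc a ha, eps_inc a ha, inc_apply, coef_gen_of_arrow a ha h, if_neg zero_ne_one, hf1, hf0,
      sub_zero, mul_one] at h1
    obtain ⟨g, hg1, hg0⟩ := ZeroAtInftyContinuousMap.exists_eq_one_of_mem_open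
      (a.map 1).open_target h.mem_target
    have h2 := hc (a.gen 1 zero_le_one ⟨g, hg0⟩)
    rw [coef_gen_of_arrow a ha h, if_pos rfl, ← h1, zero_mul] at h2
    exact one_ne_zero (hg1.symm.trans h2)
  · rintro ⟨hne, δ, hδ, hδ'⟩
    by_contra hxy
    obtain ⟨h, hh1, hh0⟩ := ZeroAtInftyContinuousMap.exists_eq_one_eq_zero hne
    refine hδ' ⟨δ (a.inc h), fun b => ?_⟩
    -- Subtracting the inner derivation with the same value at `h` makes `δ` vanish on `C₀(X)`.
    have key := a.isPointDerivation_eq_zero ha hd hxy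
      (δ := δ - δ (a.inc h) • (a.eps x - a.eps y)) ?_ ?_ b
    · rw [_root_.sub_apply, sub_eq_zero] at key
      exact key
    · intro b c
      simp only [_root_.sub_apply, _root_.smul_apply, smul_eq_mul,
        hδ b c, eps_mul a ha]
      ring
    · intro f
      have hcomm : a.inc f * a.inc h = a.inc h * a.inc f := by
        rw [inc_mul_inc, inc_mul_inc, mul_comm]
      have h1 := hδ (a.inc f) (a.inc h)
      rw [hcomm, hδ (a.inc h) (a.inc f)] at h1
      simp only [eps_inc a ha, hh1, hh0] at h1
      simp only [_root_.sub_apply, _root_.smul_apply, smul_eq_mul,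
        eps_inc a ha]
      linear_combination h1

end PointFunctionals
end PartialAction

/-! ### Isomorphisms induce conjugacies -/

namespace PartialAction

section Isomorphism

variable {X : Type u} [TopologicalSpace X] [T2Space X] (a : PartialAction ℤ X)

/-- The topology of `X` is finer than the weak topology from the functionals `ε_x`: uniform limits of
the functions `f_0` are continuous. -/
theorem continuous_eps (ha : a.IsFree) (c : a.Analytic) : Continuous fun x => a.eps x c := by
  refine a.analytic_induction (p := fun c => Continuous fun x => a.eps x c)
    (isClosed_of_closure_subset fun c hc => ?_) (fun c d hc hd => ?_) (fun n hn f => ?_) c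
  · refine continuous_of_uniform_approx_of_continuous fun u hu => ?_
    obtain ⟨ε, hε, hu⟩ := Metric.mem_uniformity_dist.1 hu
    obtain ⟨d, hd, hcd⟩ := Metric.mem_closure_iff.1 hc ε hε
    refine ⟨_, hd, fun x => hu ?_⟩
    rw [dist_eq_norm, ← map_sub]
    exact (a.norm_coef_le x x _).trans_lt (dist_eq_norm c d ▸ hcd)
  · simp only [map_add]
    exact Continuous.add hc hd
  · simp only [eps_gen a ha]
    split_ifs
    exacts [(f : C₀(X, ℂ)).continuous, continuous_const]

variable {a}
variable {Y : Type v} [TopologicalSpace Y] [T2Space Y] {b : PartialAction ℤ Y}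

/-- A homomorphism onto `C₀(Y) ×_b ℤ⁺` induces a continuous map of the character spaces. -/
theorem exists_pullback [LocallyCompactSpace X] [LocallyCompactSpace Y] (ha : a.IsFree)
    (hb : b.IsFree) (Φ : a.Analytic →L[ℂ] b.Analytic) (hmul : ∀ c d, Φ (c * d) = Φ c * Φ d)
    (hsurj : Function.Surjective Φ) :
    ∃ σ : Y → X, Continuous σ ∧ ∀ y c, b.eps y (Φ c) = a.eps (σ y) c := by
  have h : ∀ y, ∃ x, ∀ c, b.eps y (Φ c) = a.eps x c := fun y => by
    refine a.exists_eq_eps ha ((b.eps y).comp Φ) (fun c d => ?_) ?_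
    · simp only [ContinuousLinearMap.comp_apply, hmul, eps_mul b hb]
    · obtain ⟨f, hf⟩ := ZeroAtInftyContinuousMap.exists_eq_one y
      obtain ⟨c, hc⟩ := hsurj (b.inc f)
      refine ⟨c, ?_⟩
      rw [ContinuousLinearMap.comp_apply, hc, eps_inc b hb, hf]
      exact one_ne_zero
  choose σ hσ using h
  refine ⟨σ, ZeroAtInftyContinuousMap.continuous_of_continuous_comp fun f => ?_, hσ⟩
  simp only [← eps_inc a ha, ← hσ]
  exact b.continuous_eps hb _

/-- The pullback of characters along a homomorphism onto `C₀(Y) ×_b ℤ⁺` preserves orbit arrows,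
since point derivations that are not inner pull back to such derivations. -/
theorem arrow_of_pullback [LocallyCompactSpace X] [LocallyCompactSpace Y] (ha : a.IsFree)
    (hda : ∀ n : ℤ, 1 ≤ n → (a.map n).target ⊆ (a.map 1).target) (hb : b.IsFree)
    (hdb : ∀ n : ℤ, 1 ≤ n → (b.map n).target ⊆ (b.map 1).target)
    (Φ : a.Analytic →L[ℂ] b.Analytic) (hmul : ∀ c d, Φ (c * d) = Φ c * Φ d)
    (hsurj : Function.Surjective Φ) {σ : Y → X} (hσ : ∀ y c, b.eps y (Φ c) = a.eps (σ y) c)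
    {y z : Y} (h : b.Arrow 1 y z) : a.Arrow 1 (σ y) (σ z) := by
  obtain ⟨hne, δ, hδ, hδ'⟩ := (b.arrow_one_iff hb hdb).1 h
  refine (a.arrow_one_iff ha hda).2 ⟨fun h' => hne (b.eps_injective hb fun c => ?_), δ.comp Φ,
    fun c d => ?_, fun ⟨t, ht⟩ => hδ' ⟨t, fun c => ?_⟩⟩
  · obtain ⟨c, rfl⟩ := hsurj c
    rw [hσ, hσ, h']
  · simp only [ContinuousLinearMap.comp_apply, hmul, hδ _ _, hσ]
  · obtain ⟨c, rfl⟩ := hsurj c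
    rw [hσ, hσ, ← ht]
    rfl

/-- A continuous isomorphism of `C₀(X) ×_a ℤ⁺` onto `C₀(Y) ×_b ℤ⁺` yields a homeomorphism that
respects orbit arrows. -/
theorem exists_homeomorph_of_isomorphism [LocallyCompactSpace X] [LocallyCompactSpace Y]
    (ha : a.IsFree) (hda : ∀ n : ℤ, 1 ≤ n → (a.map n).target ⊆ (a.map 1).target) (hb : b.IsFree)
    (hdb : ∀ n : ℤ, 1 ≤ n → (b.map n).target ⊆ (b.map 1).target)
    (ψ : a.Analytic →ₙₐ[ℂ] b.Analytic) (hψ : Function.Bijective ψ) (hc : Continuous ψ) :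
    ∃ τ : X ≃ₜ Y, ∀ x z, a.Arrow 1 x z ↔ b.Arrow 1 (τ x) (τ z) := by
  let Φ : a.Analytic ≃L[ℂ] b.Analytic :=
    (LinearEquiv.ofBijective
      ({ toFun := ψ, map_add' := map_add ψ, map_smul' := map_smul ψ } :
        a.Analytic →ₗ[ℂ] b.Analytic) hψ).toContinuousLinearEquivOfContinuous hc
  have hmul : ∀ c d, Φ (c * d) = Φ c * Φ d := map_mul ψ
  have hmul' : ∀ c d, Φ.symm (c * d) = Φ.symm c * Φ.symm d := fun c d => by
    rw [Φ.symm_apply_eq, hmul, Φ.apply_symm_apply, Φ.apply_symm_apply]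
  obtain ⟨σ, hσc, hσ⟩ := exists_pullback ha hb (Φ : a.Analytic →L[ℂ] b.Analytic) hmul Φ.surjective
  obtain ⟨τ, hτc, hτ⟩ := exists_pullback hb ha (Φ.symm : b.Analytic →L[ℂ] a.Analytic) hmul'
    Φ.symm.surjective
  have hστ : ∀ x, σ (τ x) = x := fun x => a.eps_injective ha fun c => by
    rw [← hσ, ← hτ]
    simp
  have hτσ : ∀ y, τ (σ y) = y := fun y => b.eps_injective hb fun c => by
    rw [← hτ, ← hσ]
    simp
  refine ⟨⟨⟨τ, σ, hστ, hτσ⟩, hτc, hσc⟩, fun x z => ⟨fun h => ?_, fun h => ?_⟩⟩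
  · exact arrow_of_pullback hb hdb ha hda _ hmul' Φ.symm.surjective hτ h
  · have h' : a.Arrow 1 (σ (τ x)) (σ (τ z)) :=
      arrow_of_pullback ha hda hb hdb _ hmul Φ.surjective hσ h
    rwa [hστ, hστ] at h'

end Isomorphism

section Extension

variable {X : Type u} [TopologicalSpace X] {α : PartialAction ℕ X}

theorem extend_isFree (h : α.IsFree) : α.extend.IsFree := by
  intro t x hx hxt
  obtain ⟨n, rfl | rfl⟩ := t.eq_nat_or_neg
  · have h' := (α.extMap_arrow n _ rfl x x).1 ⟨hx, hxt⟩
    rw [h n x h'.1 h'.2, Nat.cast_zero]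
  · have h' := (α.extMap_arrow_neg n _ rfl x x).1 ⟨hx, hxt⟩
    rw [h n x h'.1 h'.2, Nat.cast_zero, neg_zero]

theorem arrow_succ_iff (h : α.DomainOrdering) (n : ℕ) (x z : X) :
    α.Arrow (n + 1) x z ↔ ∃ y, α.Arrow 1 x y ∧ α.Arrow n y z := by
  constructor
  · intro hxz
    have hx : α.Arrow 1 x (α.map 1 x) := ⟨h n 1 hxz.1, rfl⟩
    exact ⟨_, hx, α.arrow_two hx hxz⟩
  · rintro ⟨y, hxy, hyz⟩
    exact α.arrow_three hxy hyz

theorem extend_target_subset (h : α.DomainOrdering) (n : ℤ) (hn : 1 ≤ n) :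
    (α.extend.map n).target ⊆ (α.extend.map 1).target := by
  intro x hx
  obtain ⟨k, rfl⟩ := Int.eq_ofNat_of_zero_le (zero_le_one.trans hn)
  obtain ⟨m, rfl⟩ := Nat.exists_eq_add_of_le (show 1 ≤ k by omega)
  have h1 : α.Arrow (1 + m) _ x :=
    (α.extMap_arrow (1 + m) _ rfl _ x).1 (α.extend.arrow_of_mem_target hx)
  have h2 : α.Arrow m _ _ := ⟨h 1 m h1.1, rfl⟩
  exact Arrow.mem_target (a := α) (α.arrow_two h2 h1)

variable {Y : Type v} [TopologicalSpace Y] {β : PartialAction ℕ Y}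

/-- Under the domain ordering property `α_n` is the `n`-th power of `α_1`, so a homeomorphism that
intertwines `α_1` and `β_1` is a conjugacy. -/
theorem conjugate_of_arrow_one (hα : α.DomainOrdering) (hβ : β.DomainOrdering) (τ : X ≃ₜ Y)
    (h : ∀ x z, α.Arrow 1 x z ↔ β.Arrow 1 (τ x) (τ z)) : α.Conjugate β := by
  have key : ∀ n x z, α.Arrow n x z ↔ β.Arrow n (τ x) (τ z) := by
    intro n
    induction n with
    | zero =>
      intro x z
      simp only [Arrow, α.source_zero, β.source_zero, α.zero_apply, β.zero_apply, Set.mem_univ,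
        true_and, τ.injective.eq_iff]
    | succ n ih =>
      intro x z
      rw [arrow_succ_iff hα, arrow_succ_iff hβ]
      constructor
      · rintro ⟨y, hxy, hyz⟩
        exact ⟨τ y, (h _ _).1 hxy, (ih _ _).1 hyz⟩
      · rintro ⟨y, hxy, hyz⟩
        obtain ⟨y, rfl⟩ := τ.surjective y
        exact ⟨y, (h _ _).2 hxy, (ih _ _).2 hyz⟩
  refine ⟨τ, fun s => ⟨?_, ?_, fun x hx => ((key s x _).1 ⟨hx, rfl⟩).2⟩⟩
  · ext y
    constructor
    · rintro ⟨x, hx, rfl⟩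
      exact ((key s x _).1 ⟨hx, rfl⟩).1
    · intro hy
      obtain ⟨x, rfl⟩ := τ.surjective y
      obtain ⟨z, hz⟩ := τ.surjective (β.map s (τ x))
      exact ⟨x, ((key s x z).2 ⟨hy, hz.symm⟩).1, rfl⟩
  · ext y
    constructor
    · rintro ⟨x, hx, rfl⟩
      exact ((key s _ x).1 ⟨(α.map s).map_target hx, (α.map s).right_inv hx⟩).mem_target
    · intro hy
      obtain ⟨z, rfl⟩ := τ.surjective y
      obtain ⟨x, hx⟩ := τ.surjective ((β.map s).symm (τ z))
      refine ⟨z, ((key s x z).2 ?_).mem_target, rfl⟩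
      rw [hx]
      exact ⟨(β.map s).map_target hy, (β.map s).right_inv hy⟩

end Extension
end PartialAction

/-! ### Representations transferred along a conjugacy -/

/-- A closed subspace of a Hilbert space is the range of an isometry defined on an `ℓ²`-space, whose
index type lies in any universe in which a dense subset of the subspace is small. -/
theorem exists_isometry_range_eq_closure {H : Type v} [NormedAddCommGroup H] [InnerProductSpace ℂ H]
    [CompleteSpace H] (S : Submodule ℂ H) [Small.{u} S] :
    ∃ (ι : Type u) (V : lp (fun _ : ι => ℂ) 2 →ₗᵢ[ℂ] H), Set.range V = S.topologicalClosure := by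
  have hsmall : Small.{u} S.topologicalClosure := by
    have hseq : ∀ x : S.topologicalClosure, ∃ s : ℕ → S,
        Filter.Tendsto (fun n => (s n : H)) Filter.atTop (nhds x) := fun x => by
      obtain ⟨s, hs, hsx⟩ := mem_closure_iff_seq_limit.1 (show (x : H) ∈ closure (S : Set H) from x.2)
      exact ⟨fun n => ⟨s n, hs n⟩, hsx⟩
    choose s hs using hseq
    refine small_of_injective (f := s) fun x y hxy => Subtype.ext ?_
    exact tendsto_nhds_unique (hs x) (hxy ▸ hs y)
  have : CompleteSpace S.topologicalClosure := S.isClosed_topologicalClosure.completeSpace_coe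
  obtain ⟨w, b, hb⟩ := exists_hilbertBasis ℂ S.topologicalClosure
  have : Small.{u} w := small_of_injective Subtype.val_injective
  let b' : HilbertBasis (Shrink.{u} w) ℂ S.topologicalClosure :=
    HilbertBasis.mk (b.orthonormal.comp _ (equivShrink.{u} w).symm.injective) (by
      rw [EquivLike.range_comp, b.dense_span])
  refine ⟨Shrink.{u} w, S.topologicalClosure.subtypeₗᵢ.comp b'.repr.symm.toLinearIsometry, ?_⟩
  ext x
  constructor
  · rintro ⟨ξ, rfl⟩
    exact (b'.repr.symm ξ).2
  · intro hx
    exact ⟨b'.repr ⟨x, hx⟩, by simp⟩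

namespace PartialAction

section Transfer

variable {X : Type u} [TopologicalSpace X] {Y : Type v} [TopologicalSpace Y]

/-- The homeomorphism `τ` carries the orbit arrows of `a` to those of `b`, with their degrees. -/
def Intertwines (τ : X ≃ₜ Y) (a : PartialAction ℤ X) (b : PartialAction ℤ Y) : Prop :=
  ∀ n x z, a.Arrow n x z ↔ b.Arrow n (τ x) (τ z)

theorem Conjugate.exists_intertwines {α : PartialAction ℕ X} {β : PartialAction ℕ Y}
    (h : α.Conjugate β) : ∃ τ : X ≃ₜ Y, Intertwines τ α.extend β.extend := by
  obtain ⟨τ, hτ⟩ := h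
  have key : ∀ n x z, α.Arrow n x z ↔ β.Arrow n (τ x) (τ z) := fun n x z => by
    constructor
    · rintro ⟨hx, rfl⟩
      exact ⟨(hτ n).1 ▸ Set.mem_image_of_mem τ hx, (hτ n).2.2 x hx⟩
    · rintro ⟨hx, hxz⟩
      rw [← (hτ n).1, τ.injective.mem_set_image] at hx
      exact ⟨hx, τ.injective (((hτ n).2.2 x hx).symm.trans hxz)⟩
  refine ⟨τ, fun k x z => ?_⟩
  obtain ⟨n, rfl | rfl⟩ := k.eq_nat_or_neg
  · exact (α.extMap_arrow n _ rfl x z).trans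
      ((key n x z).trans (β.extMap_arrow n _ rfl (τ x) (τ z)).symm)
  · exact (α.extMap_arrow_neg n _ rfl x z).trans
      ((key n z x).trans (β.extMap_arrow_neg n _ rfl (τ x) (τ z)).symm)

namespace Intertwines

variable {τ : X ≃ₜ Y} {a : PartialAction ℤ X} {b : PartialAction ℤ Y} (h : Intertwines τ a b)

include h

theorem symm : Intertwines τ.symm b a := fun n y z => by
  rw [h, τ.apply_symm_apply, τ.apply_symm_apply]

theorem mem_target {n : ℤ} {y : Y} (hy : y ∈ (b.map n).target) :
    τ.symm y ∈ (a.map n).target :=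
  ((h.symm n _ y).1 (b.arrow_of_mem_target hy)).mem_target

theorem mem_target_iff {n : ℤ} {y : Y} : τ.symm y ∈ (a.map n).target ↔ y ∈ (b.map n).target :=
  ⟨fun hy => by simpa using h.symm.mem_target hy, h.mem_target⟩

theorem mem_source_iff {n : ℤ} {y : Y} : τ.symm y ∈ (a.map n).source ↔ y ∈ (b.map n).source := by
  rw [a.source_neg, b.source_neg]
  exact h.mem_target_iff

theorem symm_apply {n : ℤ} {y : Y} (hy : y ∈ (b.map n).target) :
    (a.map n).symm (τ.symm y) = τ.symm ((b.map n).symm y) :=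
  ((h.symm n _ y).1 (b.arrow_of_mem_target hy)).symm_apply

theorem apply {n : ℤ} {y : Y} (hy : y ∈ (b.map n).source) :
    a.map n (τ.symm y) = τ.symm (b.map n y) :=
  ((h.symm n y _).1 ⟨hy, rfl⟩).2

/-- The map `D_n → D_n`, `f ↦ f ∘ τ⁻¹`, of coefficients. -/
def coeffMap (n : ℤ) : a.ideal n →ₗ[ℂ] b.ideal n where
  toFun f := ⟨(f : C₀(X, ℂ)).comp ⟨⟨τ.symm, τ.symm.continuous⟩,
    τ.symm.isClosedEmbedding.tendsto_cocompact⟩, fun _ hy =>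
      f.2 _ fun hy' => hy (h.mem_target_iff.1 hy')⟩
  map_add' _ _ := rfl
  map_smul' _ _ := rfl

theorem coeffMap_apply {n : ℤ} (f : a.ideal n) (y : Y) :
    (h.coeffMap n f : C₀(Y, ℂ)) y = (f : C₀(X, ℂ)) (τ.symm y) := rfl

theorem norm_coeffMap_le {n : ℤ} (f : a.ideal n) :
    ‖(h.coeffMap n f : C₀(Y, ℂ))‖ ≤ ‖(f : C₀(X, ℂ))‖ :=
  ZeroAtInftyContinuousMap.norm_le_of_forall (norm_nonneg _) fun y =>
    ZeroAtInftyContinuousMap.norm_apply_le (f : C₀(X, ℂ)) (τ.symm y)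

theorem symm_coeffMap_coeffMap {n : ℤ} (f : a.ideal n) :
    h.symm.coeffMap n (h.coeffMap n f) = f := by
  ext x
  rw [coeffMap_apply, coeffMap_apply]
  simp

/-- The polynomials of `b` are in bijection with those of `a`, which live in the universe of `X`. -/
theorem small_poly : Small.{u} b.Poly :=
  small_of_surjective (α := a.Poly) (f := DirectSum.lmap h.coeffMap)
    ((DirectSum.lmap_surjective _).2 fun n g =>
      ⟨h.symm.coeffMap n g, h.symm.symm_coeffMap_coeffMap g⟩)

variable [T2Space Y]

/-- The compressions `V* ρ(f ∘ τ⁻¹ Uⁿ) V`, by which the monomials `f Uⁿ` of `a` act on a subspace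
`range V` that is invariant under a representation `ρ` of the polynomials of `b`. -/
def compress (ρ : b.Rep) {ι : Type u} (V : lp (fun _ : ι => ℂ) 2 →ₗᵢ[ℂ] ρ.H) (n : ℤ) :
    a.ideal n →ₗ[ℂ] (lp (fun _ : ι => ℂ) 2 →L[ℂ] lp (fun _ : ι => ℂ) 2) where
  toFun f := (ContinuousLinearMap.adjoint V.toContinuousLinearMap).comp
    ((ρ.hom (b.mono n (h.coeffMap n f))).comp V.toContinuousLinearMap)
  map_add' f g := by
    have : b.mono n (h.coeffMap n (f + g)) =
        b.mono n (h.coeffMap n f) + b.mono n (h.coeffMap n g) := by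
      rw [map_add]
      exact map_add (DirectSum.of (fun n => ↥(b.ideal n)) n) _ _
    rw [this, map_add]
    ext1 ξ
    simp
  map_smul' c f := by
    have : b.mono n (h.coeffMap n (c • f)) = c • b.mono n (h.coeffMap n f) := by
      rw [map_smul]
      exact map_smul (DirectSum.lof ℂ ℤ (fun n => ↥(b.ideal n)) n) c _
    rw [this, map_smul]
    ext1 ξ
    simp

/-- The range of `V` is invariant, so compression to it is restriction. -/
theorem apply_compress {ρ : b.Rep} {ι : Type u} {V : lp (fun _ : ι => ℂ) 2 →ₗᵢ[ℂ] ρ.H}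
    (hV : ∀ q ξ, ρ.hom q (V ξ) ∈ Set.range V) {n : ℤ} (f : a.ideal n)
    (ξ : lp (fun _ : ι => ℂ) 2) :
    V (h.compress ρ V n f ξ) = ρ.hom (b.mono n (h.coeffMap n f)) (V ξ) := by
  obtain ⟨ζ, hζ⟩ := hV (b.mono n (h.coeffMap n f)) ξ
  change V (ContinuousLinearMap.adjoint V.toContinuousLinearMap
    (ρ.hom (b.mono n (h.coeffMap n f)) (V ξ))) = _
  rw [← hζ]
  congr 1
  exact congrArg (fun T => T ζ) V.adjoint_comp_self

variable [T2Space X]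

theorem coeffMap_coeffMul {n k : ℤ} (f : a.ideal n) (g : a.ideal k) :
    h.coeffMap (n + k) (a.coeffMul f g) = b.coeffMul (h.coeffMap n f) (h.coeffMap k g) := by
  ext y
  rw [coeffMap_apply, coeffMul_apply, coeffMul_apply]
  by_cases hy : y ∈ (b.map n).target
  · rw [if_pos hy, if_pos (h.mem_target hy), h.symm_apply hy]
    rfl
  · rw [if_neg hy, if_neg fun hy' => hy (h.mem_target_iff.1 hy')]

theorem coeffMap_coeffStar {n : ℤ} (f : a.ideal n) :
    h.coeffMap (-n) (a.coeffStar n f) = b.coeffStar n (h.coeffMap n f) := by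
  ext y
  rw [coeffMap_apply, coeffStar_apply, coeffStar_apply]
  by_cases hy : y ∈ (b.map n).source
  · rw [if_pos hy, if_pos (h.mem_source_iff.2 hy), h.apply hy]
    rfl
  · rw [if_neg hy, if_neg fun hy' => hy (h.mem_source_iff.1 hy')]

/-- Every representation of `b` is locally, around each vector, a representation of `a` on a Hilbert
space in the universe of `a`. -/
theorem exists_rep (ρ : b.Rep) (η : ρ.H) : ∃ (π : a.Rep) (V : π.H →ₗᵢ[ℂ] ρ.H) (ξ : π.H),
    V ξ = η ∧ ∀ n f ζ, V (π.hom (a.mono n f) ζ) = ρ.hom (b.mono n (h.coeffMap n f)) (V ζ) := by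
  have := h.small_poly
  -- The cyclic subspace of `η`; the multiples of `η` are added as `ρ` may be degenerate.
  let j : ℂ × b.Poly →ₗ[ℂ] ρ.H :=
    { toFun p := p.1 • η + ρ.hom p.2 η
      map_add' p q := by
        simp only [Prod.fst_add, Prod.snd_add, map_add, add_smul, _root_.add_apply]
        abel
      map_smul' c p := by
        simp only [Prod.smul_fst, Prod.smul_snd, map_smul, smul_eq_mul, mul_smul, smul_add,
          RingHom.id_apply, _root_.smul_apply] }
  have : Small.{u} (LinearMap.range j) := small_of_surjective j.surjective_rangeRestrict
  obtain ⟨ι, V, hV⟩ := exists_isometry_range_eq_closure.{u} (LinearMap.range j)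
  have hη : η ∈ Set.range V := by
    rw [hV]
    exact subset_closure ⟨(1, 0), by simp [j]⟩
  have hinv : ∀ q ξ, ρ.hom q (V ξ) ∈ Set.range V := fun q ξ => by
    have hξ : V ξ ∈ (LinearMap.range j).topologicalClosure := by
      rw [← SetLike.mem_coe, ← hV]
      exact ⟨ξ, rfl⟩
    rw [hV]
    refine map_mem_closure (ρ.hom q).continuous hξ ?_
    rintro _ ⟨⟨c, p⟩, rfl⟩
    refine ⟨(0, c • q + q * p), ?_⟩
    simp [j, map_add, map_smul, map_mul]
  obtain ⟨ξ, hξ⟩ := hη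
  refine ⟨Rep.ofMono a (h.compress ρ V) (fun n k f g => ?_) (fun n f => ?_) (fun n f => ?_), V, ξ,
    hξ, fun n f ζ => ?_⟩
  · ext1 ζ
    refine V.injective ?_
    change _ = V (h.compress ρ V n f (h.compress ρ V k g ζ))
    rw [h.apply_compress hinv, h.apply_compress hinv, h.apply_compress hinv, h.coeffMap_coeffMul,
      ← mono_mul_mono, map_mul]
    rfl
  · change ContinuousLinearMap.comp _ (ContinuousLinearMap.comp _ _) =
      ContinuousLinearMap.adjoint (ContinuousLinearMap.comp _ (ContinuousLinearMap.comp _ _))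
    rw [ContinuousLinearMap.adjoint_comp, ContinuousLinearMap.adjoint_comp,
      ContinuousLinearMap.adjoint_adjoint, ← ContinuousLinearMap.star_eq_adjoint (ρ.hom _),
      ← map_star, star_mono, h.coeffMap_coeffStar]
    rfl
  · refine ContinuousLinearMap.opNorm_le_bound _ (norm_nonneg _) fun ζ => ?_
    rw [← V.norm_map, h.apply_compress hinv, ← V.norm_map ζ]
    refine ((ρ.hom _).le_opNorm _).trans ?_
    gcongr
    exact (ρ.norm_mono_le n _).trans (h.norm_coeffMap_le f)
  · refine Eq.trans (congrArg (fun T => V (T ζ)) (a.toModule_mono (h.compress ρ V) n f)) ?_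
    exact h.apply_compress hinv f ζ

end Intertwines

end Transfer
end PartialAction

/-! ### Conjugacies induce isomorphisms -/

namespace PartialAction

section Sums

variable {X : Type u} [TopologicalSpace X] [T2Space X] (a : PartialAction ℤ X)

/-- The class in `C₀(X) ×_a ℤ⁺` of a polynomial `∑ f_n Uⁿ`, `n ∈ ℕ`. -/
def ofSum : (⨁ n : ℕ, a.ideal n) →ₗ[ℂ] a.Analytic :=
  DirectSum.toModule ℂ ℕ a.Analytic fun n => a.gen n n.cast_nonneg

theorem ofSum_lof (n : ℕ) (f : a.ideal n) :
    a.ofSum (DirectSum.lof ℂ ℕ (fun n : ℕ => ↥(a.ideal n)) n f) = a.gen n n.cast_nonneg f :=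
  DirectSum.toModule_lof (M := fun n : ℕ => ↥(a.ideal n)) ℂ n f

theorem denseRange_ofSum : DenseRange a.ofSum := fun c => by
  refine a.analytic_induction (p := fun c => c ∈ closure (Set.range a.ofSum)) isClosed_closure
    (fun c d hc hd => ?_) (fun n hn f => ?_) c
  · have := (LinearMap.range a.ofSum).topologicalClosure.add_mem (x := c) (y := d)
    exact this hc hd
  · obtain ⟨k, rfl⟩ := Int.eq_ofNat_of_zero_le hn
    exact subset_closure ⟨_, a.ofSum_lof k f⟩

-- The direct sum is formed over additive monoids; `extendOfNorm` needs its group structure, which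
-- comes from multiplication by the scalar `-1`.
instance : AddCommGroup (⨁ n : ℕ, a.ideal n) :=
  Module.addCommMonoidToAddCommGroup ℂ

end Sums

namespace Intertwines

variable {X : Type u} [TopologicalSpace X] [T2Space X] {Y : Type v} [TopologicalSpace Y] [T2Space Y]
  {τ : X ≃ₜ Y} {a : PartialAction ℤ X} {b : PartialAction ℤ Y} (h : Intertwines τ a b)

include h

/-- The universal norms are compared vector by vector, through `exists_rep`. -/
theorem norm_ofSum_le (p : ⨁ n : ℕ, a.ideal n) :
    ‖b.ofSum (DirectSum.lmap (fun n : ℕ => h.coeffMap n) p)‖ ≤ ‖a.ofSum p‖ := by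
  refine b.norm_le_of_evalRep (norm_nonneg _) fun ρ => ?_
  refine ContinuousLinearMap.opNorm_le_bound _ (norm_nonneg _) fun η => ?_
  obtain ⟨π, V, ξ, rfl, hV⟩ := h.exists_rep ρ η
  have key : b.evalRep ρ (b.ofSum (DirectSum.lmap (fun n : ℕ => h.coeffMap n) p)) (V ξ) =
      V (a.evalRep π (a.ofSum p) ξ) := by
    induction p using DirectSum.induction_on with
    | zero => simp
    | add p q hp hq => rw [map_add, map_add, map_add, _root_.add_apply, hp, hq, map_add, map_add,
        _root_.add_apply, map_add]
    | of n f =>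
      rw [← DirectSum.lof_eq_of ℂ, DirectSum.lmap_lof, ofSum_lof, ofSum_lof, evalRep_gen,
        evalRep_gen, hV]
  rw [key, V.norm_map, V.norm_map]
  refine (ContinuousLinearMap.le_opNorm _ _).trans ?_
  gcongr
  exact a.norm_evalRep_le π _

/-- Intertwining homeomorphisms induce homomorphisms of the algebras, `∑ f_n Uⁿ ↦ ∑ f_n ∘ τ⁻¹ Uⁿ`. -/
theorem exists_hom : ∃ Φ : a.Analytic →L[ℂ] b.Analytic,
    (∀ n hn f, Φ (a.gen n hn f) = b.gen n hn (h.coeffMap n f)) ∧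
      ∀ c d, Φ (c * d) = Φ c * Φ d := by
  obtain ⟨Φ, hΦ⟩ : ∃ Φ : a.Analytic →L[ℂ] b.Analytic,
      ∀ n hn f, Φ (a.gen n hn f) = b.gen n hn (h.coeffMap n f) := by
    refine ⟨LinearMap.extendOfNorm
      (b.ofSum ∘ₗ DirectSum.lmap (fun n : ℕ => h.coeffMap n)) a.ofSum, fun n hn f => ?_⟩
    obtain ⟨k, rfl⟩ := Int.eq_ofNat_of_zero_le hn
    have h1 := LinearMap.extendOfNorm_eq
      (f := b.ofSum ∘ₗ DirectSum.lmap (fun n : ℕ => h.coeffMap n)) a.denseRange_ofSum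
      ⟨1, fun p => (h.norm_ofSum_le p).trans (one_mul _).ge⟩
      (DirectSum.lof ℂ ℕ (fun n : ℕ => ↥(a.ideal n)) k f)
    rw [ofSum_lof, LinearMap.comp_apply, DirectSum.lmap_lof, ofSum_lof] at h1
    exact h1
  refine ⟨Φ, hΦ, fun c d => ?_⟩
  refine a.analytic_induction (p := fun c => Φ (c * d) = Φ c * Φ d)
    (isClosed_eq (Φ.continuous.comp (continuous_mul_const d))
      ((continuous_mul_const _).comp Φ.continuous))
    (fun x y hx hy => ?_) (fun n hn f => ?_) c
  · rw [add_mul, map_add, hx, hy, map_add, add_mul]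
  · refine a.analytic_induction (p := fun d => Φ (a.gen n hn f * d) = Φ (a.gen n hn f) * Φ d)
      (isClosed_eq (Φ.continuous.comp (continuous_const_mul _))
        ((continuous_const_mul _).comp Φ.continuous))
      (fun x y hx hy => ?_) (fun m hm g => ?_) d
    · rw [mul_add, map_add, hx, hy, map_add, mul_add]
    · rw [gen_mul_gen, hΦ, hΦ, hΦ, gen_mul_gen, h.coeffMap_coeffMul]

theorem exists_isomorphism :
    ∃ ψ : a.Analytic →ₙₐ[ℂ] b.Analytic, Function.Bijective ψ ∧ Continuous ψ := by
  obtain ⟨Φ, hΦ, hmul⟩ := h.exists_hom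
  obtain ⟨Ψ, hΨ, -⟩ := h.symm.exists_hom
  have h1 : ∀ c, Ψ (Φ c) = c := fun c => by
    refine a.analytic_induction (p := fun c => Ψ (Φ c) = c)
      (isClosed_eq (Ψ.continuous.comp Φ.continuous) continuous_id) (fun c d hc hd => ?_)
      (fun n hn f => ?_) c
    · rw [map_add, map_add, hc, hd]
    · rw [hΦ, hΨ, h.symm_coeffMap_coeffMap]
  have h2 : ∀ c, Φ (Ψ c) = c := fun c => by
    refine b.analytic_induction (p := fun c => Φ (Ψ c) = c)
      (isClosed_eq (Φ.continuous.comp Ψ.continuous) continuous_id) (fun c d hc hd => ?_)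
      (fun n hn f => ?_) c
    · rw [map_add, map_add, hc, hd]
    · rw [hΨ, hΦ]
      exact congrArg _ (h.symm.symm_coeffMap_coeffMap f)
  exact ⟨{ toFun := Φ, map_smul' := map_smul Φ, map_zero' := map_zero Φ, map_add' := map_add Φ,
           map_mul' := hmul }, ⟨fun c d hcd => by rw [← h1 c, ← h1 d]; exact congrArg Ψ hcd,
    fun c => ⟨Ψ c, h2 c⟩⟩, Φ.continuous⟩

end Intertwines
end PartialAction

end

theorem theorem6p1 {X : Type*} [TopologicalSpace X] [LocallyCompactSpace X] [T2Space X]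
    {Y : Type*} [TopologicalSpace Y] [LocallyCompactSpace Y] [T2Space Y]
    (α : PartialAction ℕ X) (β : PartialAction ℕ Y)
    (hα : α.IsFree) (hβ : β.IsFree) (hα' : α.DomainOrdering) (hβ' : β.DomainOrdering) :
    (∃ ψ : α.semicrossedProduct →ₙₐ[ℂ] β.semicrossedProduct,
      Function.Bijective ψ ∧ Continuous ψ) ↔ α.Conjugate β := by
  constructor
  · rintro ⟨ψ, hψ, hc⟩
    obtain ⟨τ, hτ⟩ := PartialAction.exists_homeomorph_of_isomorphism (a := α.extend) (b := β.extend)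
      (PartialAction.extend_isFree hα) (PartialAction.extend_target_subset hα')
      (PartialAction.extend_isFree hβ) (PartialAction.extend_target_subset hβ') ψ hψ hc
    exact PartialAction.conjugate_of_arrow_one hα' hβ' τ hτ
  · intro h
    obtain ⟨τ, hτ⟩ := h.exists_intertwines
    exact hτ.exists_isomorphism
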